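/- Let $a, d$ be positive integers with $ad \neq 1$. For $j=1,2$ let $\mathscr T^{(j)}$, with vertex set $V^{(j)} = V^{(j)}_1\times\cdots\times V^{(j)}_d$, be the directed Cartesian product of rooted directed trees $\mathscr T^{(j)}_1,\dots,\mathscr T^{(j)}_d$, each of which is locally finite, leafless (every vertex has a child) and has finite branching index (the depths of the vertices with at least two children are bounded). *Notation (index $j$ suppressed).* For $v\in V$ let $\mathsf d_v=(\mathsf d_{v_1},\dots,\mathsf d_{v_d})\in\mathbb N^d$ be the vector of depths of its coordinates, $|\mathsf d_v|=\sum_i\mathsf d_{v_i}$, and $\mathsf{root}$ the vertex all of whose coordinates are roots. $\mathsf{Chi}_i(v)$ is the set of vertices obtained from $v$ by replacing $v_i$ by one of its children; if $v_i$ is not the root, $\mathsf{par}_i(v)$ is obtained by replacing $v_i$ by its parent, and $\mathsf{sib}_i(v)=\mathsf{Chi}_i(\mathsf{par}_i(v))$. Let $S_1,\dots,S_d$ be the bounded operators on $\ell^2(V)$ given by $(S_if)(w)=\lambda_i(w)f(\mathsf{par}_i(w))$ if $w_i$ is not the root and $(S_if)(w)=0$ otherwise, where $$\lambda_i(w)=\sqrt{\frac{\mathfrak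 c_a(|\mathsf d_v|)}{\operatorname{card}\mathsf{Chi}_i(v)}}\sqrt{\frac{\mathsf d_{v_i}+1}{|\mathsf d_v|+d}},\qquad w\in\mathsf{Chi}_i(v),\qquad \mathfrak c_a(t)=\frac{t+d}{t+a},$$ and let $E=\bigcap_{i=1}^d\ker S_i^*$. For $F\subseteq\{1,\dots,d\}$ let $\Phi_F$ be the set of $v\in V$ such that $v_i$ is not the root exactly when $i\in F$; for $u\in\Phi_F$ let $\mathsf{sib}_F(u)$ be the set of $v \in V$ such that $v_i$ has the same parent as $u_i$ for $i\in F$ and $v_i=u_i$ for $i\notin F$. These sets partition $\Phi_F$; let $\Omega_F\subseteq\Phi_F$ contain exactly one element of each of them. For $u\in\Omega_F$ let $\mathcal L_{u,F}$ be the space of all $f\in\ell^2(V)$ that vanish outside $\mathsf{sib}_F(u)$ and satisfy $$\sum_{w\in\mathsf{sib}_i(v)}f(w)\lambda_i(w)=0\qquad\text{for all } i\in F \text{ and } v\in\mathsf{sib}_F(u).$$ Then $E$ is the orthogonal direct sum of the $\mathcal L_{u,F}$. Let $\mathscr H_{\mathfrak c_a}(\mathscr T)$ be the Hilbert space of $E$-valued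 functions on the open unit ball of $\mathbb C^d$ with reproducing kernel $$\kappa(z,w)=\sum_{F\subseteq\{1,\dots,d\}}\ \sum_{u\in\Omega_F}\Big(\sum_{\alpha\in\mathbb N^d}\frac{\mathsf d_u!}{(\mathsf d_u+\alpha)!}\prod_{l=0}^{|\alpha|-1}(|\mathsf d_u|+a+l)\,z^\alpha\overline w^{\alpha}\Big)P_{\mathcal L_{u,F}},$$ where $P_{\mathcal L_{u,F}}$ is the orthogonal projection of $E$ onto $\mathcal L_{u,F}$. The operators $\mathscr M_{z_1},\dots,\mathscr M_{z_d}$ of multiplication by the coordinate functions are bounded on $\mathscr H_{\mathfrak c_a}(\mathscr T)$, and $E$ embeds in it as the subspace of constant functions. **Proposition.** Let $U:\mathscr H_{\mathfrak c_a}(\mathscr T^{(1)})\to\mathscr H_{\mathfrak c_a}(\mathscr T^{(2)})$ be a Hilbert module isomorphism, that is, a unitary map with $U\mathscr M^{(1)}_{z_k}=\mathscr M^{(2)}_{z_k}U$ for $k=1,\dots,d$. Then, for every $\alpha\in\mathbb N^d$ and every $F\subseteq\{1,\dots,d\}$, $$U\Big(\bigoplus_{u\in\Omega^{(1)}_F,\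 \mathsf d_u=\alpha}\mathcal L^{(1)}_{u,F}\Big)=\bigoplus_{v\in\Omega^{(2)}_F,\ \mathsf d_v=\alpha}\mathcal L^{(2)}_{v,F},$$ where an empty direct sum is $\{0\}$ and the spaces $\mathcal L^{(j)}_{u,F}$ are regarded as spaces of constant functions. In particular, $U$ maps $e_{\mathsf{root}^{(1)}}$ to a unimodular scalar multiple of $e_{\mathsf{root}^{(2)}}$, where $e_{\mathsf{root}^{(j)}}$ is the indicator function of $\{\mathsf{root}^{(j)}\}$, regarded as a constant function. -/

import Mathlib

noncomputable section

open scoped ComplexConjugate ComplexOrder InnerProductSpace lp Nat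

/-- A rooted directed tree: every vertex except the root has exactly one parent, the root has no
parent, and every vertex is reached from the root along directed edges. -/
structure RootedDirectedTree (V : Type*) extends Digraph V where
  root : V
  not_adj_root : ∀ u, ¬ Adj u root
  existsUnique_parent : ∀ v, v ≠ root → ∃! u, Adj u v
  reachable : ∀ v, Relation.ReflTransGen Adj root v

namespace RootedDirectedTree

variable {V : Type*} (T : RootedDirectedTree V)

/-- The set of children of `v`. -/
def children (v : V) : Set V := {w | T.Adj v w}

open Classical in
/-- The parent of `v`; by convention the root is sent to itself. -/
def parent (v : V) : V :=
  if h : v = T.root then T.root else (T.existsUnique_parent v h).choose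

/-- The siblings of `v` (including `v`), i.e. the children of the parent of `v`;
the root has no siblings. -/
def siblings (v : V) : Set V := {w | v ≠ T.root ∧ T.Adj (T.parent v) w}

/-- The depth of `v`, i.e. the length of the path from the root to `v`. -/
def depth (v : V) : ℕ := sInf {n | T.parent^[n] v = T.root}

/-- A branching vertex is a vertex with at least two children. -/
def IsBranching (v : V) : Prop := 2 ≤ (T.children v).encard

/-- The branching index: `1 + sup` of the depths of the branching vertices, and `0` if there are
none; it is `⊤` if these depths are unbounded. -/
def branchingIndex : ℕ∞ := ⨆ (v : V) (_ : T.IsBranching v), ((T.depth v : ℕ∞) + 1)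

/-- Every vertex has finitely many children. -/
class LocallyFinite : Prop where
  finite_children : ∀ v, (T.children v).Finite

/-- Every vertex has a child. -/
class Leafless : Prop where
  nonempty_children : ∀ v, (T.children v).Nonempty

/-- The branching index is finite. A directed Cartesian product has finite joint branching index
if this holds for each of its factors. -/
class FiniteBranchingIndex : Prop where
  branchingIndex_ne_top : T.branchingIndex ≠ ⊤

lemma parent_root : T.parent T.root = T.root := by simp [parent]

lemma adj_parent {v : V} (h : v ≠ T.root) : T.Adj (T.parent v) v := by
  simp only [parent, h, dif_neg, not_false_eq_true]
  exact (T.existsUnique_parent v h).choose_spec.1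

lemma parent_eq {u v : V} (h : T.Adj u v) : T.parent v = u := by
  have hv : v ≠ T.root := by
    rintro rfl
    exact T.not_adj_root _ h
  exact (T.existsUnique_parent v hv).unique (T.adj_parent hv) h

lemma exists_iterate_parent (v : V) : ∃ n, T.parent^[n] v = T.root := by
  induction T.reachable v with
  | refl => exact ⟨0, rfl⟩
  | tail _ h ih =>
    obtain ⟨n, hn⟩ := ih
    exact ⟨n + 1, by rw [Function.iterate_succ_apply, T.parent_eq h, hn]⟩

lemma iterate_depth (v : V) : T.parent^[T.depth v] v = T.root :=
  Nat.sInf_mem (T.exists_iterate_parent v)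

lemma finite_siblings [T.LocallyFinite] (v : V) : (T.siblings v).Finite :=
  (LocallyFinite.finite_children (T := T) (T.parent v)).subset fun _ hw => hw.2

lemma finite_depth_le [T.LocallyFinite] (n : ℕ) : {v | T.depth v ≤ n}.Finite := by
  have key : ∀ n, {v | T.parent^[n] v = T.root}.Finite := by
    intro n
    induction n with
    | zero => simp
    | succ n ih =>
      refine ((ih.biUnion fun v _ => LocallyFinite.finite_children (T := T) v).union
        (Set.finite_singleton T.root)).subset ?_
      intro v hv
      by_cases h : v = T.root
      · exact Or.inr h
      · exact Or.inl (Set.mem_biUnion (x := T.parent v) hv (T.adj_parent h))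
  refine (key n).subset fun v hv => ?_
  obtain ⟨k, rfl⟩ := Nat.exists_eq_add_of_le hv
  change T.parent^[T.depth v + k] v = T.root
  rw [Nat.add_comm, Function.iterate_add_apply, T.iterate_depth]
  exact Function.iterate_fixed T.parent_root k

lemma finite_isBranching [T.LocallyFinite] [T.FiniteBranchingIndex] :
    {v | T.IsBranching v}.Finite := by
  obtain ⟨n, hn⟩ := ENat.ne_top_iff_exists.1
    (FiniteBranchingIndex.branchingIndex_ne_top (T := T))
  refine (T.finite_depth_le n).subset fun v hv => ?_
  have h : ((T.depth v : ℕ∞) + 1) ≤ T.branchingIndex :=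
    le_iSup₂ (f := fun (v : V) (_ : T.IsBranching v) => ((T.depth v : ℕ∞) + 1)) v hv
  rw [← hn] at h
  have h' : T.depth v + 1 ≤ n := by exact_mod_cast h
  exact (Nat.le_succ _).trans h'

end RootedDirectedTree

namespace TreeProduct

open RootedDirectedTree

variable {d : ℕ} {V : Fin d → Type*} (T : ∀ i, RootedDirectedTree (V i))

/-- The directed Cartesian product of `T 0, …, T (d - 1)`. -/
def digraph : Digraph (∀ i, V i) where
  Adj v w := ∃ k, (∀ j, j ≠ k → v j = w j) ∧ (T k).Adj (v k) (w k)

/-- The root of the directed Cartesian product. -/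
def root : ∀ i, V i := fun i => (T i).root

/-- The depth `𝖽_v ∈ ℕ^d` of a vertex. -/
def depth (v : ∀ i, V i) : Fin d → ℕ := fun i => (T i).depth (v i)

/-- `|𝖽_v|`. -/
def height (v : ∀ i, V i) : ℕ := ∑ i, depth T v i

/-- `Chi_j(v)`. -/
def childrenAt (j : Fin d) (v : ∀ i, V i) : Set (∀ i, V i) :=
  {w | (∀ i, i ≠ j → w i = v i) ∧ w j ∈ (T j).children (v j)}

/-- `par_j(v)`. -/
def parentAt (j : Fin d) (v : ∀ i, V i) : ∀ i, V i :=
  Function.update v j ((T j).parent (v j))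

/-- `sib_j(v)`. -/
def sibAt (j : Fin d) (v : ∀ i, V i) : Set (∀ i, V i) :=
  {w | (∀ i, i ≠ j → w i = v i) ∧ w j ∈ (T j).siblings (v j)}

/-- `Φ_F`: the vertices whose non-root coordinates are exactly those in `F`. -/
def Phi (F : Finset (Fin d)) : Set (∀ i, V i) := {v | ∀ i, v i ≠ (T i).root ↔ i ∈ F}

/-- `sib_F(u) = sib_{i₁} ⋯ sib_{iₖ}(u)` for `F = {i₁, …, iₖ}`. -/
def sib (F : Finset (Fin d)) (u : ∀ i, V i) : Set (∀ i, V i) :=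
  {w | (∀ i, i ∉ F → w i = u i) ∧ ∀ i ∈ F, w i ∈ (T i).siblings (u i)}

/-- `v_G`: the coordinates outside `G` are replaced by the roots. -/
def restrict (G : Finset (Fin d)) (v : ∀ i, V i) : ∀ i, V i :=
  fun i => if i ∈ G then v i else (T i).root

/-- The sequence `𝔠_a(t) = (t + d) / (t + a)`. -/
def cSeq (d a t : ℕ) : ℝ := ((t : ℝ) + d) / ((t : ℝ) + a)

/-- The weights of the Drury-Arveson-type multishift:
`λ_j(w) = √(𝔠_a(|𝖽_v|) / card Chi_j(v)) √((𝖽_{v_j} + 1) / (|𝖽_v| + d))` for `w ∈ Chi_j(v)`. -/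
def weight (a : ℕ) (j : Fin d) (w : ∀ i, V i) : ℝ :=
  √(cSeq d a (height T (parentAt T j w)) / (childrenAt T j (parentAt T j w)).ncard) *
    √((depth T (parentAt T j w) j + 1) / (height T (parentAt T j w) + d))

open Classical in
/-- The function `Λ^{(j)} f` underlying the `j`-th component of the multishift. -/
def shiftFun (a : ℕ) (j : Fin d) (f : (∀ i, V i) → ℂ) : (∀ i, V i) → ℂ :=
  fun w => if w j = (T j).root then 0 else (weight T a j w : ℂ) * f (parentAt T j w)

lemma finite_childrenAt [∀ i, (T i).LocallyFinite] (j : Fin d) (v : ∀ i, V i) :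
    (childrenAt T j v).Finite := by
  refine ((LocallyFinite.finite_children (T := T j) (v j)).image
    fun x => Function.update v j x).subset ?_
  rintro w ⟨h1, h2⟩
  refine ⟨w j, h2, ?_⟩
  ext i
  by_cases h : i = j
  · subst h; simp
  · simp [h, h1 i h]

lemma sum_weight_sq_le [∀ i, (T i).LocallyFinite] (a : ℕ) (j : Fin d) (v : ∀ i, V i)
    (s : Finset (∀ i, V i)) (hs : ∀ w ∈ s, w j ≠ (T j).root ∧ parentAt T j w = v) :
    ∑ w ∈ s, weight T a j w ^ 2 ≤ 2 := by
  have hsub : (s : Set (∀ i, V i)) ⊆ childrenAt T j v := by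
    intro w hw
    obtain ⟨h1, h2⟩ := hs w hw
    subst h2
    refine ⟨fun i hi => by simp [parentAt, hi], ?_⟩
    simpa [parentAt, children] using (T j).adj_parent h1
  have hcard : s.card ≤ (childrenAt T j v).ncard := by
    rw [← Set.ncard_coe_finset]
    exact Set.ncard_le_ncard hsub (finite_childrenAt T j v)
  have hd : 0 < d := j.pos
  have hle : depth T v j ≤ height T v :=
    Finset.single_le_sum (f := fun i => depth T v i) (fun _ _ => Nat.zero_le _) (Finset.mem_univ j)
  set m : ℕ := height T v with hm
  set n : ℕ := (childrenAt T j v).ncard with hn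
  have hW : ∀ w ∈ s, weight T a j w ^ 2 =
      (((m : ℝ) + d) / (m + a) / n) * ((depth T v j + 1) / (m + d)) := by
    intro w hw
    simp only [weight, (hs w hw).2, cSeq]
    rw [mul_pow, Real.sq_sqrt (by positivity), Real.sq_sqrt (by positivity)]
  rw [Finset.sum_congr rfl hW, Finset.sum_const, nsmul_eq_mul]
  have hle' : (depth T v j : ℝ) ≤ m := by exact_mod_cast hle
  have hcard' : (s.card : ℝ) ≤ n := by exact_mod_cast hcard
  have hd' : (0 : ℝ) < d := by exact_mod_cast hd
  have e : (s.card : ℝ) * (((m : ℝ) + d) / (m + a) / n * ((depth T v j + 1) / (m + d))) =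
      (s.card / n) * ((depth T v j + 1) / (m + a)) := by
    have : (m : ℝ) + d ≠ 0 := by positivity
    field_simp
  rw [e]
  have h1 : (s.card : ℝ) / n ≤ 1 := div_le_one_of_le₀ hcard' (by positivity)
  have h2 : ((depth T v j : ℝ) + 1) / (m + a) ≤ 2 := by
    rcases Nat.eq_zero_or_pos (m + a) with h0 | h0
    · have : (m : ℝ) + a = 0 := by exact_mod_cast h0
      simp [this]
    · have h0' : (1 : ℝ) ≤ (m : ℝ) + a := by exact_mod_cast h0
      rw [div_le_iff₀ (by linarith)]
      have : (0 : ℝ) ≤ a := by positivity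
      linarith
  calc _ ≤ 1 * (2 : ℝ) := mul_le_mul h1 h2 (by positivity) zero_le_one
    _ = 2 := one_mul _

lemma sum_shiftFun_le [∀ i, (T i).LocallyFinite] (a : ℕ) (j : Fin d)
    (f : ℓ²((∀ i, V i), ℂ)) (s : Finset (∀ i, V i)) :
    ∑ w ∈ s, ‖shiftFun T a j f w‖ ^ 2 ≤ 2 * ‖f‖ ^ 2 := by
  classical
  have hsum : ∀ t : Finset (∀ i, V i), ∑ v ∈ t, ‖f v‖ ^ 2 ≤ ‖f‖ ^ 2 := by
    intro t
    have := lp.sum_rpow_le_norm_rpow (p := 2) (by norm_num) f t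
    simpa using this
  set s' := s.filter fun w => w j ≠ (T j).root with hs'
  have h1 : ∑ w ∈ s, ‖shiftFun T a j f w‖ ^ 2 =
      ∑ w ∈ s', weight T a j w ^ 2 * ‖f (parentAt T j w)‖ ^ 2 := by
    rw [hs', Finset.sum_filter]
    refine Finset.sum_congr rfl fun w _ => ?_
    by_cases h : w j = (T j).root <;> simp [shiftFun, h, mul_pow]
  rw [h1, ← Finset.sum_fiberwise_of_maps_to (s := s') (t := s'.image (parentAt T j))
    (g := parentAt T j) fun w hw => Finset.mem_image_of_mem _ hw]
  calc _ ≤ ∑ v ∈ s'.image (parentAt T j), 2 * ‖f v‖ ^ 2 := by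
        refine Finset.sum_le_sum fun v _ => ?_
        have h2 : ∑ w ∈ s' with parentAt T j w = v,
              weight T a j w ^ 2 * ‖f (parentAt T j w)‖ ^ 2 =
            (∑ w ∈ s' with parentAt T j w = v, weight T a j w ^ 2) * ‖f v‖ ^ 2 := by
          rw [Finset.sum_mul]
          refine Finset.sum_congr rfl fun w hw => ?_
          rw [(Finset.mem_filter.1 hw).2]
        rw [h2]
        refine mul_le_mul_of_nonneg_right (sum_weight_sq_le T a j v _ fun w hw => ?_)
          (by positivity)
        simp only [hs', Finset.mem_filter] at hw
        exact ⟨hw.1.2, hw.2⟩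
    _ ≤ _ := by
        rw [← Finset.mul_sum]
        exact mul_le_mul_of_nonneg_left (hsum _) (by norm_num)

/-- The `j`-th component `S_j` of the Drury-Arveson-type multishift on `ℓ²(V)`. -/
def shift [∀ i, (T i).LocallyFinite] (a : ℕ) (j : Fin d) :
    ℓ²((∀ i, V i), ℂ) →L[ℂ] ℓ²((∀ i, V i), ℂ) :=
  LinearMap.mkContinuous
    { toFun := fun f => ⟨shiftFun T a j f, memℓp_gen' (C := 2 * ‖f‖ ^ 2) fun s => by
        simpa using sum_shiftFun_le T a j f s⟩
      map_add' := fun f g => by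
        ext w
        change shiftFun T a j _ w = shiftFun T a j f w + shiftFun T a j g w
        by_cases h : w j = (T j).root <;> simp [shiftFun, h, mul_add]
      map_smul' := fun c f => by
        ext w
        by_cases h : w j = (T j).root <;> simp [shiftFun, h, mul_left_comm] }
    2 fun f => by
      refine lp.norm_le_of_forall_sum_le (by norm_num) (by positivity) fun s => ?_
      have := sum_shiftFun_le T a j f s
      have h : (2 * ‖f‖) ^ 2 = 4 * ‖f‖ ^ 2 := by ring
      simp only [ENNReal.toReal_ofNat, Real.rpow_ofNat, h]
      refine le_trans this ?_
      nlinarith [sq_nonneg ‖f‖]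

lemma shift_apply [∀ i, (T i).LocallyFinite] (a : ℕ) (j : Fin d) (f : ℓ²((∀ i, V i), ℂ))
    (w : ∀ i, V i) : shift T a j f w = shiftFun T a j f w := rfl

/-- The joint kernel `E = ⋂_j ker S_j^*`. -/
def jointKernel [∀ i, (T i).LocallyFinite] (a : ℕ) : Submodule ℂ ℓ²((∀ i, V i), ℂ) :=
  ⨅ j, (ContinuousLinearMap.adjoint (shift T a j)).ker

instance [∀ i, (T i).LocallyFinite] (a : ℕ) : CompleteSpace (jointKernel T a) := by
  refine IsClosed.completeSpace_coe (hs := ?_)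
  simp only [jointKernel, Submodule.coe_iInf]
  exact isClosed_iInter fun j => ContinuousLinearMap.isClosed_ker _

lemma finite_sibAt [∀ i, (T i).LocallyFinite] (j : Fin d) (v : ∀ i, V i) :
    (sibAt T j v).Finite := by
  refine (((T j).finite_siblings (v j)).image fun x => Function.update v j x).subset ?_
  rintro w ⟨h1, h2⟩
  refine ⟨w j, h2, ?_⟩
  ext i
  by_cases h : i = j
  · subst h; simp
  · simp [h, h1 i h]

lemma finite_sib [∀ i, (T i).LocallyFinite] (F : Finset (Fin d)) (u : ∀ i, V i) :
    (sib T F u).Finite := by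
  classical
  refine (Set.Finite.pi' (t := fun i => (T i).siblings (u i) ∪ {u i}) fun i =>
    ((T i).finite_siblings (u i)).union (Set.finite_singleton _)).subset ?_
  rintro w ⟨h1, h2⟩ i
  by_cases h : i ∈ F
  · exact Or.inl (h2 i h)
  · exact Or.inr (h1 i h)

/-- `𝓛_{u,F} ⊆ ℓ²(sib_F(u))`: the solution space of the system
`∑_{w ∈ sib_j(v_G | u_j)} f(w) λ_j(w) = 0`, where `j ∈ F`, `G = F \ {j}` and `v ∈ sib_F(u)`.
Here `v_G | u_j` is `v_G` with the `j`-th coordinate replaced by `u_j`. -/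
def solutionSpace [∀ i, (T i).LocallyFinite] (a : ℕ) (u : ∀ i, V i) (F : Finset (Fin d)) :
    Submodule ℂ ℓ²((∀ i, V i), ℂ) where
  carrier := {f | (∀ w, w ∉ sib T F u → f w = 0) ∧ ∀ j ∈ F, ∀ v ∈ sib T F u,
    ∑ᶠ w ∈ sibAt T j (Function.update (restrict T (F \ {j}) v) j (u j)),
      f w * (weight T a j w : ℂ) = 0}
  zero_mem' := by simp
  add_mem' := by
    rintro f g ⟨hf1, hf2⟩ ⟨hg1, hg2⟩
    refine ⟨fun w hw => by simp [hf1 w hw, hg1 w hw], fun j hj v hv => ?_⟩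
    have h := finsum_mem_add_distrib (f := fun w => f w * (weight T a j w : ℂ))
      (g := fun w => g w * (weight T a j w : ℂ))
      (finite_sibAt T j (Function.update (restrict T (F \ {j}) v) j (u j)))
    rw [hf2 j hj v hv, hg2 j hj v hv, add_zero] at h
    simpa [add_mul] using h
  smul_mem' := by
    rintro c f ⟨hf1, hf2⟩
    refine ⟨fun w hw => by simp [hf1 w hw], fun j hj v hv => ?_⟩
    have h := mul_finsum_mem
      (s := sibAt T j (Function.update (restrict T (F \ {j}) v) j (u j)))
      (fun w => f w * (weight T a j w : ℂ)) c
    rw [hf2 j hj v hv, mul_zero] at h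
    simpa [mul_assoc] using h.symm

instance [∀ i, (T i).LocallyFinite] (a : ℕ) (u : ∀ i, V i) (F : Finset (Fin d)) :
    FiniteDimensional ℂ (solutionSpace T a u F) := by
  have := (finite_sib T F u).to_subtype
  let q : solutionSpace T a u F →ₗ[ℂ] (sib T F u → ℂ) :=
    { toFun := fun f w => f.1 w
      map_add' := fun f g => by ext; simp
      map_smul' := fun c f => by ext; simp }
  refine FiniteDimensional.of_injective q fun f g h => ?_
  ext w
  by_cases hw : w ∈ sib T F u
  · exact congrFun h ⟨w, hw⟩
  · rw [f.2.1 w hw, g.2.1 w hw]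

/-- `𝓛_{u,F}` as a subspace of `E`; for `u ∈ Φ_F` one has `𝓛_{u,F} ⊆ E`, see
`mem_solutionSpace_iff`. -/
def solutionSpaceIn [∀ i, (T i).LocallyFinite] (a : ℕ) (u : ∀ i, V i) (F : Finset (Fin d)) :
    Submodule ℂ (jointKernel T a) :=
  (solutionSpace T a u F).submoduleOf (jointKernel T a)

instance [∀ i, (T i).LocallyFinite] (a : ℕ) (u : ∀ i, V i) (F : Finset (Fin d)) :
    FiniteDimensional ℂ (solutionSpaceIn T a u F) := by
  let q : solutionSpaceIn T a u F →ₗ[ℂ] solutionSpace T a u F :=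
    { toFun := fun f => ⟨f.1.1, f.2⟩
      map_add' := fun f g => rfl
      map_smul' := fun c f => rfl }
  refine FiniteDimensional.of_injective q fun f g h => Subtype.ext (Subtype.ext ?_)
  exact congrArg (fun x : solutionSpace T a u F => x.1) h

/-- A choice of indexing sets `Ω_F`, `F ⊆ {1, …, d}`: each `Ω_F` consists of exactly one element
from each of the equivalence classes `sib_F(u)`, `u ∈ Φ_F`. -/
structure IndexingSystem where
  Ω : Finset (Fin d) → Set (∀ i, V i)
  subset_Phi : ∀ F, Ω F ⊆ Phi T F
  existsUnique_mem : ∀ F, ∀ v ∈ Phi T F, ∃! u, u ∈ Ω F ∧ v ∈ sib T F u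

/-- The coefficient `𝖽_u! / (𝖽_u + α)! ∏_{j < |α|} (|𝖽_u| + a + j)`. -/
def kernelCoeff (a : ℕ) (u : ∀ i, V i) (α : Fin d → ℕ) : ℝ :=
  ((∏ i, (depth T u i)! : ℕ) : ℝ) / ((∏ i, (depth T u i + α i)! : ℕ) : ℝ) *
    ∏ j ∈ Finset.range (∑ i, α i), ((height T u : ℝ) + a + j)

/-- The open unit ball of `ℂ^d`. -/
abbrev UnitBall (d : ℕ) : Type := Metric.ball (0 : EuclideanSpace ℂ (Fin d)) 1

/-- The `i`-th coordinate of a point of the unit ball. -/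
abbrev UnitBall.coord {d : ℕ} (i : Fin d) (z : UnitBall d) : ℂ := z.1 i

/-- The monomial `z^α`. -/
def monomial (α : Fin d → ℕ) (z : UnitBall d) : ℂ := ∏ i, UnitBall.coord i z ^ α i

/-- The scalar kernel
`∑_α 𝖽_u! / (𝖽_u + α)! ∏_{j < |α|} (|𝖽_u| + a + j) z^α conj(w)^α`. -/
def scalarKernel (a : ℕ) (u : ∀ i, V i) (z w : UnitBall d) : ℂ :=
  ∑' α : Fin d → ℕ, (kernelCoeff T a u α : ℂ) * (monomial α z * conj (monomial α w))

variable {T} in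
/-- The `B(E)`-valued kernel of the Drury-Arveson-type space:
`κ(z, w) = ∑_F ∑_{u ∈ Ω_F} κ_u(z, w) P_{𝓛_{u,F}}`, with `κ_u` the scalar kernel of `u` and
`P_{𝓛_{u,F}}` the orthogonal projection of `E` onto `𝓛_{u,F}`. -/
def kernel [∀ i, (T i).LocallyFinite] (a : ℕ) (I : IndexingSystem T) :
    Matrix (UnitBall d) (UnitBall d) (jointKernel T a →L[ℂ] jointKernel T a) :=
  .of fun z w => ∑ F : Finset (Fin d), ∑' u : I.Ω F,
    scalarKernel T a u z w • (solutionSpaceIn T a u F).starProjection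

/-! ### Positivity of the kernel -/

lemma kernelCoeff_nonneg (a : ℕ) (u : ∀ i, V i) (α : Fin d → ℕ) : 0 ≤ kernelCoeff T a u α := by
  unfold kernelCoeff
  positivity

lemma kernelCoeff_le (a : ℕ) (u : ∀ i, V i) (α : Fin d → ℕ) :
    kernelCoeff T a u α ≤ ((∑ i, α i + (height T u + a)).choose (height T u + a) : ℝ) *
      Nat.multinomial Finset.univ α := by
  set n := ∑ i, α i with hn
  set m := height T u + a with hm
  have h1 : ∏ j ∈ Finset.range n, ((height T u : ℝ) + a + j) ≤ ((m + 1).ascFactorial n : ℝ) := by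
    rw [Nat.ascFactorial_eq_prod_range]
    push_cast
    refine Finset.prod_le_prod (fun j _ => by positivity) fun j _ => ?_
    rw [hm]; push_cast; linarith
  have h2 : ((∏ i, (depth T u i)! : ℕ) : ℝ) / ((∏ i, (depth T u i + α i)! : ℕ) : ℝ) ≤
      1 / ((∏ i, (α i)! : ℕ) : ℝ) := by
    rw [div_le_div_iff₀ (by positivity) (by positivity), one_mul]
    rw [← Nat.cast_mul, ← Finset.prod_mul_distrib]
    exact_mod_cast Finset.prod_le_prod' fun i _ =>
      Nat.le_of_dvd (Nat.factorial_pos _) (Nat.factorial_mul_factorial_dvd_factorial_add _ _)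
  have h3 : ((m + 1).ascFactorial n : ℝ) = n ! * (n + m).choose m := by
    rw [Nat.ascFactorial_eq_factorial_mul_choose, Nat.add_comm m n, Nat.choose_symm_add]
    push_cast; rfl
  have h4 : (Nat.multinomial Finset.univ α : ℝ) = n ! / ((∏ i, (α i)! : ℕ) : ℝ) := by
    rw [eq_div_iff (by positivity), mul_comm]
    exact_mod_cast Nat.multinomial_spec Finset.univ α
  calc kernelCoeff T a u α
      ≤ 1 / ((∏ i, (α i)! : ℕ) : ℝ) * (n ! * (n + m).choose m) := by
        rw [← h3]
        exact mul_le_mul h2 h1 (Finset.prod_nonneg fun _ _ => by positivity) (by positivity)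
    _ = _ := by rw [h4]; ring

lemma summable_kernelCoeff (a : ℕ) (u : ∀ i, V i) (x : Fin d → ℝ) (hx : ∀ i, 0 ≤ x i)
    (hx1 : ∑ i, x i < 1) :
    Summable fun α : Fin d → ℕ => kernelCoeff T a u α * ∏ i, x i ^ α i := by
  classical
  set m := height T u + a with hm
  set r := ∑ i, x i with hr
  have hr0 : 0 ≤ r := Finset.sum_nonneg fun i _ => hx i
  have hs : Summable fun n : ℕ => ((n + m).choose m : ℝ) * r ^ n :=
    summable_choose_mul_geometric_of_norm_lt_one m (by rwa [Real.norm_of_nonneg hr0])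
  have hp : ∀ α : Fin d → ℕ, 0 ≤ ∏ i, x i ^ α i := fun α =>
    Finset.prod_nonneg fun i _ => pow_nonneg (hx i) _
  refine summable_of_sum_le (c := ∑' n : ℕ, ((n + m).choose m : ℝ) * r ^ n)
    (fun α => mul_nonneg (kernelCoeff_nonneg T a u α) (hp α)) fun s => ?_
  set t := s.image fun α => ∑ i, α i with ht
  rw [← Finset.sum_fiberwise_of_maps_to (s := s) (t := t) (g := fun α => ∑ i, α i)
    fun α hα => Finset.mem_image_of_mem _ hα]
  refine le_trans (Finset.sum_le_sum fun n _ => ?_)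
    (hs.sum_le_tsum t fun n _ => by positivity)
  calc ∑ α ∈ s with ∑ i, α i = n, kernelCoeff T a u α * ∏ i, x i ^ α i
      ≤ ∑ α ∈ s with ∑ i, α i = n,
          ((n + m).choose m : ℝ) * (Nat.multinomial Finset.univ α * ∏ i, x i ^ α i) := by
        refine Finset.sum_le_sum fun α hα => ?_
        rw [← mul_assoc]
        refine mul_le_mul_of_nonneg_right ?_ (hp α)
        have := kernelCoeff_le T a u α
        rwa [(Finset.mem_filter.1 hα).2] at this
    _ ≤ ∑ α ∈ Finset.piAntidiag Finset.univ n,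
          ((n + m).choose m : ℝ) * (Nat.multinomial Finset.univ α * ∏ i, x i ^ α i) := by
        refine Finset.sum_le_sum_of_subset_of_nonneg (fun α hα => ?_) fun α _ _ => ?_
        · simpa [Finset.mem_piAntidiag] using (Finset.mem_filter.1 hα).2
        · have := hp α
          positivity
    _ = _ := by
        rw [← Finset.mul_sum, hr, Finset.sum_pow_eq_sum_piAntidiag]

lemma sum_norm_coord_mul_lt_one (z w : UnitBall d) :
    ∑ i, ‖UnitBall.coord i z‖ * ‖UnitBall.coord i w‖ < 1 := by
  have hz : ‖z.1‖ < 1 := mem_ball_zero_iff.1 z.2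
  have hw : ‖w.1‖ < 1 := mem_ball_zero_iff.1 w.2
  have h := Real.sum_mul_le_sqrt_mul_sqrt Finset.univ
    (fun i => ‖UnitBall.coord i z‖) fun i => ‖UnitBall.coord i w‖
  rw [← EuclideanSpace.norm_eq, ← EuclideanSpace.norm_eq] at h
  exact h.trans_lt (mul_lt_one_of_nonneg_of_lt_one_left (norm_nonneg _) hz hw.le)

lemma summable_scalarKernel (a : ℕ) (u : ∀ i, V i) (b : (Fin d → ℕ) → ℝ) (hb : ∀ α, 0 ≤ b α)
    (hbc : ∀ α, b α ≤ kernelCoeff T a u α) (z w : UnitBall d) :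
    Summable fun α => (b α : ℂ) * (monomial α z * conj (monomial α w)) := by
  refine Summable.of_norm_bounded (g := fun α => kernelCoeff T a u α *
    ∏ i, (‖UnitBall.coord i z‖ * ‖UnitBall.coord i w‖) ^ α i)
    (summable_kernelCoeff T a u _ (fun i => by positivity) (sum_norm_coord_mul_lt_one z w))
    fun α => ?_
  have : ‖monomial α z * conj (monomial α w)‖ =
      ∏ i, (‖UnitBall.coord i z‖ * ‖UnitBall.coord i w‖) ^ α i := by
    simp [monomial, norm_prod, mul_pow, Finset.prod_mul_distrib]
  rw [norm_mul, this, Complex.norm_real, Real.norm_of_nonneg (hb α)]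
  exact mul_le_mul_of_nonneg_right (hbc α) (Finset.prod_nonneg fun i _ => by positivity)

lemma weight_pos [∀ i, (T i).LocallyFinite] (a : ℕ) [NeZero a] (j : Fin d) (w : ∀ i, V i)
    (hw : w j ≠ (T j).root) : 0 < weight T a j w := by
  have ha : (0 : ℝ) < a := by exact_mod_cast Nat.pos_of_neZero a
  have hd : (0 : ℝ) < d := by exact_mod_cast j.pos
  have hmem : w ∈ childrenAt T j (parentAt T j w) := by
    refine ⟨fun i hi => by simp [parentAt, hi], ?_⟩
    simpa [parentAt, children] using (T j).adj_parent hw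
  have hn : 0 < (childrenAt T j (parentAt T j w)).ncard :=
    (Set.ncard_pos (finite_childrenAt T j _)).2 ⟨w, hmem⟩
  have hn' : (0 : ℝ) < (childrenAt T j (parentAt T j w)).ncard := by exact_mod_cast hn
  unfold weight cSeq
  positivity

lemma isBranching_of_solutionSpace_ne_bot [∀ i, (T i).LocallyFinite] (a : ℕ) [NeZero a]
    (u : ∀ i, V i) (F : Finset (Fin d)) (hu : u ∈ Phi T F) (h : solutionSpace T a u F ≠ ⊥)
    (j : Fin d) (hj : j ∈ F) : (T j).IsBranching ((T j).parent (u j)) := by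
  by_contra hb
  refine h ((Submodule.eq_bot_iff _).2 fun f hf => ?_)
  ext v
  change f v = 0
  by_cases hv : v ∈ sib T F u
  swap
  · exact hf.1 v hv
  have hu0 : u j ≠ (T j).root := (hu j).2 hj
  have hle : ((T j).children ((T j).parent (u j))).encard ≤ 1 := by
    have h1 := not_le.1 hb
    exact Order.le_of_lt_add_one (by simpa [one_add_one_eq_two] using h1)
  have huniq : ∀ x ∈ (T j).siblings (u j), x = u j := fun x hx =>
    Set.encard_le_one_iff.1 hle _ _ hx.2 ((T j).adj_parent hu0)
  have hset : sibAt T j (Function.update (restrict T (F \ {j}) v) j (u j)) = {v} := by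
    have hvj : v j = u j := huniq _ (hv.2 j hj)
    have hupd : Function.update (restrict T (F \ {j}) v) j (u j) = v := by
      ext i
      by_cases hi : i = j
      · subst hi; simp [hvj]
      · by_cases hiF : i ∈ F
        · simp [hi, restrict, hiF]
        · have : v i = (T i).root := by
            rw [hv.1 i hiF]
            by_contra hne
            exact hiF ((hu i).1 hne)
          simp [hi, restrict, hiF, this]
    rw [hupd]
    ext w
    simp only [sibAt, Set.mem_ofPred_eq, Set.mem_singleton_iff]
    constructor
    · rintro ⟨h1, h2⟩
      ext i
      by_cases hi : i = j
      · subst hi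
        rw [hvj] at h2 ⊢
        exact huniq _ h2
      · exact h1 i hi
    · rintro rfl
      refine ⟨fun _ _ => rfl, ?_⟩
      rw [hvj]
      exact ⟨hu0, (T j).adj_parent hu0⟩
  have heq := hf.2 j hj v hv
  rw [hset, finsum_mem_singleton] at heq
  have hvr : v j ≠ (T j).root := by rw [huniq _ (hv.2 j hj)]; exact hu0
  rcases mul_eq_zero.1 heq with h0 | h0
  · exact h0
  · exact absurd (by exact_mod_cast h0) (weight_pos T a j v hvr).ne'

/-! ### Description of `E` and of the projections onto `𝓛_{u,F}` -/

lemma mem_childrenAt_iff (j : Fin d) (v w : ∀ i, V i) :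
    w ∈ childrenAt T j v ↔ w j ≠ (T j).root ∧ parentAt T j w = v := by
  constructor
  · rintro ⟨h1, h2⟩
    refine ⟨fun h => (T j).not_adj_root (v j) (h ▸ h2), ?_⟩
    ext i
    by_cases h : i = j
    · subst h; simpa [parentAt] using (T i).parent_eq h2
    · simp [parentAt, h, h1 i h]
  · rintro ⟨h1, rfl⟩
    refine ⟨fun i hi => by simp [parentAt, hi], ?_⟩
    simpa [parentAt, children] using (T j).adj_parent h1

open Classical in
lemma adjoint_shift_apply [∀ i, (T i).LocallyFinite] (a : ℕ) (j : Fin d)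
    (f : ℓ²((∀ i, V i), ℂ)) (v : ∀ i, V i) :
    ContinuousLinearMap.adjoint (shift T a j) f v =
      ∑ᶠ w ∈ childrenAt T j v, f w * (weight T a j w : ℂ) := by
  have h := lp.inner_single_left (𝕜 := ℂ) v (1 : ℂ) (ContinuousLinearMap.adjoint (shift T a j) f)
  have h' : ContinuousLinearMap.adjoint (shift T a j) f v =
      ⟪lp.single 2 v (1 : ℂ), ContinuousLinearMap.adjoint (shift T a j) f⟫_ℂ := by
    rw [h]; simp
  rw [h', ContinuousLinearMap.adjoint_inner_right, lp.inner_eq_tsum,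
    finsum_mem_eq_finite_toFinset_sum _ (finite_childrenAt T j v), tsum_eq_sum]
  rotate_right
  · exact (finite_childrenAt T j v).toFinset
  · refine Finset.sum_congr rfl fun w hw => ?_
    have hw' := (mem_childrenAt_iff T j v w).1 (by simpa using hw)
    simp [shift_apply, shiftFun, hw'.1, hw'.2]
  · intro w hw
    have hw' : ¬ _ := fun h => hw ((Set.Finite.mem_toFinset _).2 ((mem_childrenAt_iff T j v w).2 h))
    by_cases h0 : w j = (T j).root
    · simp [shift_apply, shiftFun, h0]
    · have : parentAt T j w ≠ v := fun h => hw' ⟨h0, h⟩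
      simp [shift_apply, shiftFun, h0, this]

lemma mem_jointKernel_iff [∀ i, (T i).LocallyFinite] (a : ℕ) (f : ℓ²((∀ i, V i), ℂ)) :
    f ∈ jointKernel T a ↔ ∀ j v, ∑ᶠ w ∈ childrenAt T j v, f w * (weight T a j w : ℂ) = 0 := by
  simp only [jointKernel, Submodule.mem_iInf, ← adjoint_shift_apply]
  refine forall_congr' fun j => ?_
  constructor
  · intro h v
    have h : ContinuousLinearMap.adjoint (shift T a j) f = 0 := h
    rw [h]; rfl
  · intro h
    change ContinuousLinearMap.adjoint (shift T a j) f = 0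
    ext v; exact h v

lemma sibAt_eq (j : Fin d) (F : Finset (Fin d)) (u v : ∀ i, V i) (hu : u ∈ Phi T F) (hj : j ∈ F)
    (hv : v ∈ sib T F u) :
    sibAt T j (Function.update (restrict T (F \ {j}) v) j (u j)) =
      childrenAt T j (parentAt T j v) := by
  have hp : (T j).parent (v j) = (T j).parent (u j) := (T j).parent_eq (hv.2 j hj).2
  have hr : ∀ i, i ≠ j → restrict T (F \ {j}) v i = v i := by
    intro i hi
    by_cases hiF : i ∈ F
    · simp [restrict, hi, hiF]
    · have : v i = (T i).root := by
        rw [hv.1 i hiF]; by_contra hne; exact hiF ((hu i).1 hne)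
      simp [restrict, hiF, this]
  ext w
  constructor
  · rintro ⟨h1, h2⟩
    refine ⟨fun i hi => by simpa [parentAt, hi, hr i hi] using h1 i hi, ?_⟩
    have := h2.2
    simp only [Function.update_self] at this
    simpa [parentAt, children, hp] using this
  · rintro ⟨h1, h2⟩
    refine ⟨fun i hi => by simpa [parentAt, hi, hr i hi] using h1 i hi, ?_⟩
    simp only [Function.update_self]
    refine ⟨(hu j).2 hj, ?_⟩
    simpa [parentAt, children, hp] using h2

lemma childrenAt_subset (j : Fin d) (F : Finset (Fin d)) (u v w : ∀ i, V i) (hu : u ∈ Phi T F)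
    (hv : v ∈ sib T F u) (hvj : v j ≠ (T j).root) (hw : w ∈ childrenAt T j (parentAt T j v)) :
    j ∈ F ∧ w ∈ sib T F u := by
  have hj : j ∈ F := by
    by_contra hj
    rw [hv.1 j hj] at hvj
    exact hj ((hu j).1 hvj)
  refine ⟨hj, ?_⟩
  have hp : (T j).parent (v j) = (T j).parent (u j) := (T j).parent_eq (hv.2 j hj).2
  refine ⟨fun i hi => ?_, fun i hi => ?_⟩
  · have hij : i ≠ j := fun h => hi (h ▸ hj)
    rw [hw.1 i hij]; simpa [parentAt, hij] using hv.1 i hi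
  · by_cases hij : i = j
    · subst hij
      refine ⟨(hu i).2 hi, ?_⟩
      simpa [parentAt, children, hp] using hw.2
    · rw [hw.1 i hij]; simpa [parentAt, hij] using hv.2 i hi

lemma mem_solutionSpace_iff [∀ i, (T i).LocallyFinite] (a : ℕ) (u : ∀ i, V i)
    (F : Finset (Fin d)) (hu : u ∈ Phi T F) (f : ℓ²((∀ i, V i), ℂ)) :
    f ∈ solutionSpace T a u F ↔ (∀ w, w ∉ sib T F u → f w = 0) ∧ f ∈ jointKernel T a := by
  rw [mem_jointKernel_iff]
  constructor
  · rintro ⟨h1, h2⟩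
    refine ⟨h1, fun j v => ?_⟩
    by_cases h : ∃ w ∈ childrenAt T j v, w ∈ sib T F u
    · obtain ⟨w, hw, hwu⟩ := h
      obtain ⟨hw1, rfl⟩ := (mem_childrenAt_iff T j v w).1 hw
      obtain ⟨hj, -⟩ := childrenAt_subset T j F u w w hu hwu hw1 hw
      rw [← sibAt_eq T j F u w hu hj hwu]
      exact h2 j hj w hwu
    · push Not at h
      refine finsum_mem_eq_zero_of_forall_eq_zero fun w hw => ?_
      rw [h1 w (h w hw), zero_mul]
  · rintro ⟨h1, h2⟩
    refine ⟨h1, fun j hj v hv => ?_⟩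
    rw [sibAt_eq T j F u v hu hj hv]
    exact h2 j _

open Classical in
lemma exists_restrict [∀ i, (T i).LocallyFinite] (a : ℕ) (u : ∀ i, V i)
    (F : Finset (Fin d)) (hu : u ∈ Phi T F) (f : ℓ²((∀ i, V i), ℂ)) (hf : f ∈ jointKernel T a) :
    ∃ g ∈ solutionSpace T a u F, ∀ w, g w = if w ∈ sib T F u then f w else 0 := by
  let g : ℓ²((∀ i, V i), ℂ) := ⟨fun w => if w ∈ sib T F u then f w else 0,
    (lp.memℓp f).mono' fun w => by split_ifs <;> simp⟩
  have hg : ∀ w, g w = if w ∈ sib T F u then f w else 0 := fun w => rfl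
  refine ⟨g, (mem_solutionSpace_iff T a u F hu g).2 ⟨fun w hw => by rw [hg, if_neg hw], ?_⟩, hg⟩
  rw [mem_jointKernel_iff] at hf ⊢
  intro j v
  by_cases h : ∃ w ∈ childrenAt T j v, w ∈ sib T F u
  · obtain ⟨w, hw, hwu⟩ := h
    obtain ⟨hw1, rfl⟩ := (mem_childrenAt_iff T j v w).1 hw
    rw [← hf j (parentAt T j w)]
    refine finsum_mem_congr rfl fun w' hw' => ?_
    rw [hg, if_pos (childrenAt_subset T j F u w w' hu hwu hw1 hw').2]
  · push Not at h
    refine finsum_mem_eq_zero_of_forall_eq_zero fun w hw => ?_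
    rw [hg, if_neg (h w hw), zero_mul]

open Classical in
lemma starProjection_apply [∀ i, (T i).LocallyFinite] (a : ℕ) (u : ∀ i, V i)
    (F : Finset (Fin d)) (hu : u ∈ Phi T F) (f : jointKernel T a) (w : ∀ i, V i) :
    ((solutionSpaceIn T a u F).starProjection f).1 w = if w ∈ sib T F u then f.1 w else 0 := by
  obtain ⟨g, hg1, hg2⟩ := exists_restrict T a u F hu f.1 f.2
  have hgE : g ∈ jointKernel T a := ((mem_solutionSpace_iff T a u F hu g).1 hg1).2
  have : (solutionSpaceIn T a u F).starProjection f = ⟨g, hgE⟩ := by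
    refine Submodule.eq_starProjection_of_mem_of_inner_eq_zero (by exact hg1) fun x hx => ?_
    have hx' : x.1 ∈ solutionSpace T a u F := hx
    rw [Submodule.coe_inner, lp.inner_eq_tsum]
    refine (tsum_congr fun v => ?_).trans tsum_zero
    have e : (f - ⟨g, hgE⟩ : jointKernel T a).1 v = f.1 v - g v := rfl
    rw [e, hg2]
    by_cases hv : v ∈ sib T F u
    · simp [hv]
    · rw [hx'.1 v hv]; simp
  rw [this]; exact hg2 w

lemma scalarKernel_zero (a : ℕ) (u : ∀ i, V i) (z w : UnitBall d) (hw : w.1 = 0) :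
    scalarKernel T a u z w = 1 := by
  unfold scalarKernel
  rw [tsum_eq_single 0]
  · have : ((∏ i, (depth T u i).factorial : ℕ) : ℝ) ≠ 0 := by positivity
    simp [kernelCoeff, monomial]
    have h2 : (∏ i, ((depth T u i).factorial : ℂ)) ≠ 0 :=
      Finset.prod_ne_zero_iff.2 fun i _ => by exact_mod_cast Nat.factorial_ne_zero _
    exact h2
  · intro α hα
    obtain ⟨i, hi⟩ := Function.ne_iff.1 hα
    have : monomial α w = 0 := Finset.prod_eq_zero (Finset.mem_univ i) (by
      simp only [UnitBall.coord, hw]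
      simpa using hi)
    simp [this]

variable {T}

lemma finite_solutionSpaceIn_ne_bot [∀ i, (T i).LocallyFinite] [∀ i, (T i).FiniteBranchingIndex]
    (a : ℕ) [NeZero a] (I : IndexingSystem T) (F : Finset (Fin d)) :
    {u : I.Ω F | solutionSpaceIn T a u F ≠ ⊥}.Finite := by
  have hfin : {u : ∀ i, V i | ∀ i, u i ∈
      {(T i).root} ∪ ⋃ p ∈ {p | (T i).IsBranching p}, (T i).children p}.Finite :=
    Set.Finite.pi' fun i => (Set.finite_singleton _).union
      ((T i).finite_isBranching.biUnion fun p _ => LocallyFinite.finite_children p)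
  refine Set.Finite.of_finite_image (f := Subtype.val) (hfin.subset ?_)
    Subtype.val_injective.injOn
  rintro _ ⟨u, hu, rfl⟩ i
  have hΦ := I.subset_Phi F u.2
  by_cases hi : i ∈ F
  · have hne : solutionSpace T a u F ≠ ⊥ := by
      intro h0
      refine hu ((Submodule.eq_bot_iff _).2 fun f hf => ?_)
      have : f.1 ∈ solutionSpace T a u F := hf
      rw [h0, Submodule.mem_bot] at this
      exact Subtype.ext this
    exact Or.inr (Set.mem_biUnion (x := (T i).parent (u.1 i))
      (isBranching_of_solutionSpace_ne_bot T a u F hΦ hne i hi) ((T i).adj_parent ((hΦ i).2 hi)))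
  · refine Or.inl ?_
    by_contra h
    exact hi ((hΦ i).1 h)

lemma posSemidef_diagonal {E : Type*} [NormedAddCommGroup E] [InnerProductSpace ℂ E]
    [CompleteSpace E] (S : Submodule ℂ E) [S.HasOrthogonalProjection]
    (b : (Fin d → ℕ) → ℝ) (hb : ∀ α, 0 ≤ b α)
    (hs : ∀ z w : UnitBall d, Summable fun α => (b α : ℂ) * (monomial α z * conj (monomial α w))) :
    (Matrix.of fun z w : UnitBall d =>
      (∑' α, (b α : ℂ) * (monomial α z * conj (monomial α w))) • S.starProjection).PosSemidef := by
  have e := (RKHS.posSemidef_tfae (K := Matrix.of fun z w : UnitBall d =>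
    (∑' α, (b α : ℂ) * (monomial α z * conj (monomial α w))) • S.starProjection)).out 2 0
  have hconj : ∀ z w : UnitBall d,
      conj (∑' α, (b α : ℂ) * (monomial α z * conj (monomial α w))) =
        ∑' α, (b α : ℂ) * (monomial α w * conj (monomial α z)) := by
    intro z w
    rw [Complex.conj_tsum]
    refine tsum_congr fun α => ?_
    simp [mul_comm]
  refine e.1 ⟨?_, fun vv => ?_⟩
  · ext1 z w
    rw [Matrix.conjTranspose_apply, Matrix.of_apply, Matrix.of_apply, star_smul,
      (isSelfAdjoint_starProjection S).star_eq, RCLike.star_def, hconj]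
  · have key : HasSum (fun α => (b α : ℂ) *
        ((‖∑ x ∈ vv.support, conj (monomial α x) • S.starProjection (vv x)‖ ^ 2 : ℝ) : ℂ))
        (vv.sum fun x w => vv.sum fun x' w' =>
          ⟪(Matrix.of (fun z w : UnitBall d =>
            (∑' α, (b α : ℂ) * (monomial α z * conj (monomial α w))) • S.starProjection)) x' x w,
            w'⟫_ℂ) := by
      have h0 : HasSum (fun α => ∑ x ∈ vv.support, ∑ x' ∈ vv.support,
          ((b α : ℂ) * (monomial α x * conj (monomial α x'))) *
            ⟪S.starProjection (vv x), vv x'⟫_ℂ)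
          (∑ x ∈ vv.support, ∑ x' ∈ vv.support,
            (∑' α, (b α : ℂ) * (monomial α x * conj (monomial α x'))) *
              ⟪S.starProjection (vv x), vv x'⟫_ℂ) :=
        hasSum_sum fun x _ => hasSum_sum fun x' _ => (hs x x').hasSum.mul_right _
      convert h0 using 1
      · ext α
        have h2 : ∀ x x', ⟪S.starProjection (vv x), S.starProjection (vv x')⟫_ℂ =
            ⟪S.starProjection (vv x), vv x'⟫_ℂ := by
          intro x x'
          rw [← S.inner_starProjection_left_eq_right,
            Submodule.starProjection_eq_self_iff.2 (Submodule.starProjection_apply_mem _ _)]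
        have h3 := inner_self_eq_norm_sq_to_K (𝕜 := ℂ)
          (∑ x ∈ vv.support, conj (monomial α x) • S.starProjection (vv x))
        rw [Complex.ofReal_pow]
        refine (congrArg (fun t => (b α : ℂ) * t) h3.symm).trans ?_
        simp only [sum_inner, inner_sum, inner_smul_left, inner_smul_right, h2, Finset.mul_sum,
          RCLike.conj_conj]
        rw [Finset.sum_comm]
        refine Finset.sum_congr rfl fun x _ => Finset.sum_congr rfl fun x' _ => ?_
        ring
      · simp only [Finsupp.sum, Matrix.of_apply, FunLike.coe_smul, Pi.smul_apply, inner_smul_left,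
          hconj]
    have := Complex.hasSum_re key
    refine this.nonneg fun α => ?_
    rw [← Complex.ofReal_mul, Complex.ofReal_re]
    exact mul_nonneg (hb α) (by positivity)

lemma kernel_eq_sum [∀ i, (T i).LocallyFinite] [∀ i, (T i).FiniteBranchingIndex]
    (a : ℕ) [NeZero a] (I : IndexingSystem T) (z w : UnitBall d) :
    kernel a I z w = ∑ F : Finset (Fin d), ∑ u ∈ (finite_solutionSpaceIn_ne_bot a I F).toFinset,
      scalarKernel T a u z w • (solutionSpaceIn T a u F).starProjection := by
  simp only [kernel, Matrix.of_apply]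
  refine Finset.sum_congr rfl fun F _ => ?_
  refine tsum_eq_sum fun u hu => ?_
  have : solutionSpaceIn T a u F = ⊥ := by simpa using hu
  simp [this]

lemma posSemidef_kernel [∀ i, (T i).LocallyFinite] [∀ i, (T i).FiniteBranchingIndex]
    (a : ℕ) [NeZero a] (I : IndexingSystem T) : (kernel a I).PosSemidef := by
  have h : kernel a I = ∑ F : Finset (Fin d),
      ∑ u ∈ (finite_solutionSpaceIn_ne_bot a I F).toFinset,
        Matrix.of fun z w => scalarKernel T a u z w • (solutionSpaceIn T a u F).starProjection := by
    ext1 z w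
    simp only [kernel_eq_sum, Matrix.sum_apply, Matrix.of_apply]
  rw [h]
  refine Matrix.posSemidef_sum _ fun F _ => Matrix.posSemidef_sum _ fun u _ => ?_
  exact posSemidef_diagonal _ (kernelCoeff T a u) (kernelCoeff_nonneg T a u)
    (summable_scalarKernel T a u _ (kernelCoeff_nonneg T a u) fun _ => le_rfl)

instance [∀ i, (T i).LocallyFinite] [∀ i, (T i).FiniteBranchingIndex]
    (a : ℕ) [NeZero a] (I : IndexingSystem T) : Fact (kernel a I).PosSemidef :=
  ⟨posSemidef_kernel a I⟩

/-! ### Multiplication by the coordinate functions -/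

lemma exists_mul_of_posSemidef {X E H : Type*} [NormedAddCommGroup E] [InnerProductSpace ℂ E]
    [CompleteSpace E] [NormedAddCommGroup H] [InnerProductSpace ℂ H] [CompleteSpace H]
    [RKHS ℂ H X E] (m : X → ℂ)
    (hm : (Matrix.of fun x y => (1 - m x * conj (m y)) • RKHS.kernel H x y).PosSemidef) :
    ∃ M : H →L[ℂ] H, ∀ f x, M f x = m x • f x := by
  let e : (X →₀ E) →ₗ[ℂ] H := Finsupp.lsum ℂ fun x => (RKHS.kerFun H x).toLinearMap
  let t : (X →₀ E) →ₗ[ℂ] H := Finsupp.lsum ℂ fun x => conj (m x) • (RKHS.kerFun H x).toLinearMap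
  have he : ∀ x v, e (Finsupp.single x v) = RKHS.kerFun H x v := fun x v => by simp [e]
  have ht : ∀ x v, t (Finsupp.single x v) = conj (m x) • RKHS.kerFun H x v := fun x v => by
    simp [t]
  have hdense : DenseRange e := by
    have h := RKHS.kerFun_dense (𝕜 := ℂ) H
    have hle : Submodule.span ℂ {RKHS.kerFun H x v | (x) (v)} ≤ LinearMap.range e := by
      rw [Submodule.span_le]
      rintro _ ⟨x, v, rfl⟩
      exact ⟨Finsupp.single x v, he x v⟩
    rw [DenseRange, dense_iff_closure_eq, Set.eq_univ_iff_forall]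
    intro y
    have hy : y ∈ (Submodule.span ℂ {RKHS.kerFun H x v | (x) (v)}).topologicalClosure := by
      rw [h]; trivial
    exact closure_mono (fun z hz => hle hz) hy
  have hbound : ∀ vv, ‖t vv‖ ≤ 1 * ‖e vv‖ := by
    intro vv
    have h0 := (RKHS.posSemidef_tfae (K := Matrix.of fun x y =>
      (1 - m x * conj (m y)) • RKHS.kernel H x y)).out 0 2
    have h := (h0.1 hm).2 vv
    have h1 : (vv.sum fun x w => vv.sum fun x' w' =>
        ⟪(Matrix.of fun x y => (1 - m x * conj (m y)) • RKHS.kernel H x y) x' x w, w'⟫_ℂ) =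
        ⟪e vv, e vv⟫_ℂ - ⟪t vv, t vv⟫_ℂ := by
      have h2 : e vv = ∑ x ∈ vv.support, RKHS.kerFun H x (vv x) := by
        simp [e, Finsupp.lsum_apply, Finsupp.sum]
      have h3 : t vv = ∑ x ∈ vv.support, conj (m x) • RKHS.kerFun H x (vv x) := by
        simp [t, Finsupp.lsum_apply, Finsupp.sum]
      rw [h2, h3]
      simp only [Finsupp.sum, sum_inner, inner_sum, ← Finset.sum_sub_distrib]
      rw [Finset.sum_comm]
      refine (Finset.sum_congr rfl fun x _ => Finset.sum_congr rfl fun x' _ => ?_)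
      simp only [Matrix.of_apply, FunLike.coe_smul, Pi.smul_apply, inner_smul_left,
        inner_smul_right, RKHS.kernel_inner, map_sub, map_mul, map_one, RCLike.conj_conj]
      ring
    rw [h1, map_sub, inner_self_eq_norm_sq, inner_self_eq_norm_sq, sub_nonneg] at h
    rw [one_mul]
    exact (sq_le_sq₀ (norm_nonneg _) (norm_nonneg _)).1 h
  refine ⟨ContinuousLinearMap.adjoint (t.extendOfNorm e), fun f x => ?_⟩
  refine ext_inner_left ℂ fun v => ?_
  rw [← RKHS.kerFun_inner, ContinuousLinearMap.adjoint_inner_right, ← he,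
    LinearMap.extendOfNorm_eq hdense ⟨1, hbound⟩, ht, inner_smul_left, RKHS.kerFun_inner,
    inner_smul_right, RCLike.conj_conj]

/-- The coefficients of `(1 - z_k conj(w_k)) κ_u(z, w)`. -/
lemma one_sub_mul_scalarKernel (a : ℕ) (u : ∀ i, V i) (k : Fin d) (z w : UnitBall d) :
    (1 - UnitBall.coord k z * conj (UnitBall.coord k w)) * scalarKernel T a u z w =
      ∑' α : Fin d → ℕ, ((kernelCoeff T a u α -
        (if α k = 0 then 0 else kernelCoeff T a u (α - Pi.single k 1)) : ℝ) : ℂ) *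
          (monomial α z * conj (monomial α w)) := by
  have hs := summable_scalarKernel T a u _ (kernelCoeff_nonneg T a u) (fun _ => le_rfl) z w
  have hm : ∀ (α : Fin d → ℕ) (z : UnitBall d),
      monomial (α + Pi.single k 1) z = UnitBall.coord k z * monomial α z := by
    intro α z
    simp only [monomial, Pi.add_apply, pow_add, Finset.prod_mul_distrib]
    rw [mul_comm]
    congr 1
    rw [Finset.prod_eq_single k] <;> simp +contextual
  have hinj : Function.Injective fun α : Fin d → ℕ => α + Pi.single k 1 :=
    fun _ _ h => add_right_cancel h
  set g : (Fin d → ℕ) → ℂ := fun α =>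
    ((if α k = 0 then 0 else kernelCoeff T a u (α - Pi.single k 1) : ℝ) : ℂ) *
      (monomial α z * conj (monomial α w)) with hg
  have hg1 : ∀ α, g (α + Pi.single k 1) =
      UnitBall.coord k z * conj (UnitBall.coord k w) *
        ((kernelCoeff T a u α : ℂ) * (monomial α z * conj (monomial α w))) := by
    intro α
    simp only [hg, hm, map_mul]
    simp
    ring
  have hsupp : ∀ α ∉ Set.range (fun α : Fin d → ℕ => α + Pi.single k 1), g α = 0 := by
    intro α hα
    have : α k = 0 := by
      by_contra h
      refine hα ⟨α - Pi.single k 1, ?_⟩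
      ext i
      by_cases hi : i = k
      · subst hi; simp; omega
      · simp [hi]
    simp [hg, this]
  have hg2 : HasSum g (UnitBall.coord k z * conj (UnitBall.coord k w) * scalarKernel T a u z w) := by
    rw [← hinj.hasSum_iff hsupp]
    refine HasSum.congr_fun ?_ hg1
    exact hs.hasSum.mul_left _
  have h := (hs.hasSum.sub hg2).tsum_eq
  rw [sub_mul, one_mul]
  refine h.symm.trans (tsum_congr fun α => ?_)
  simp only [hg, Complex.ofReal_sub]
  ring

lemma kernelCoeff_sub_single_le (a : ℕ) [NeZero a] (u : ∀ i, V i) (k : Fin d) (α : Fin d → ℕ) :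
    (if α k = 0 then 0 else kernelCoeff T a u (α - Pi.single k 1)) ≤ kernelCoeff T a u α := by
  split_ifs with h
  · exact kernelCoeff_nonneg T a u α
  obtain ⟨β, rfl⟩ : ∃ β : Fin d → ℕ, α = β + Pi.single k 1 := by
    refine ⟨α - Pi.single k 1, ?_⟩
    ext i
    by_cases hi : i = k
    · subst hi; simp; omega
    · simp [hi]
  rw [add_tsub_cancel_right]
  have ha : (1 : ℝ) ≤ a := by exact_mod_cast NeZero.one_le
  have hsum : ∑ i, (β + Pi.single k 1 : Fin d → ℕ) i = ∑ i, β i + 1 := by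
    simp [Finset.sum_add_distrib]
  have hprod : ∏ i, (depth T u i + (β + Pi.single k 1 : Fin d → ℕ) i)! =
      (∏ i, (depth T u i + β i)!) * (depth T u k + β k + 1) := by
    rw [← Finset.mul_prod_erase _ _ (Finset.mem_univ k),
      ← Finset.mul_prod_erase _ (fun i => (depth T u i + β i)!) (Finset.mem_univ k)]
    have : ∀ i ∈ Finset.univ.erase k, (depth T u i + (β + Pi.single k 1 : Fin d → ℕ) i)! =
        (depth T u i + β i)! := by
      intro i hi
      simp [(Finset.mem_erase.1 hi).1]
    rw [Finset.prod_congr rfl this]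
    simp only [Pi.add_apply, Pi.single_eq_same, ← add_assoc, Nat.factorial_succ]
    ring
  unfold kernelCoeff
  rw [hsum, hprod, Finset.prod_range_succ]
  have h1 : depth T u k ≤ height T u :=
    Finset.single_le_sum (f := fun i => depth T u i) (fun _ _ => Nat.zero_le _) (Finset.mem_univ k)
  have h2 : β k ≤ ∑ i, β i :=
    Finset.single_le_sum (f := fun i => β i) (fun _ _ => Nat.zero_le _) (Finset.mem_univ k)
  have h1' : (depth T u k : ℝ) ≤ height T u := by exact_mod_cast h1
  have h2' : (β k : ℝ) ≤ (∑ i, β i : ℕ) := by exact_mod_cast h2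
  set A : ℝ := ((∏ i, (depth T u i)! : ℕ) : ℝ)
  set B : ℝ := ((∏ i, (depth T u i + β i)! : ℕ) : ℝ) with hB
  set C : ℝ := ∏ j ∈ Finset.range (∑ i, β i), ((height T u : ℝ) + a + j)
  have hB0 : 0 < B := by rw [hB]; positivity
  have hAC : 0 ≤ A / B * C := by
    have : 0 ≤ A := by positivity
    have : 0 ≤ C := Finset.prod_nonneg fun _ _ => by positivity
    positivity
  have e : A / ((((∏ i, (depth T u i + β i)!) * (depth T u k + β k + 1) : ℕ)) : ℝ) *
      (C * ((height T u : ℝ) + a + (∑ i, β i : ℕ))) =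
      A / B * C * (((height T u : ℝ) + a + (∑ i, β i : ℕ)) / (depth T u k + β k + 1)) := by
    rw [Nat.cast_mul]
    push_cast [hB]
    field_simp
  rw [e]
  refine le_mul_of_one_le_right hAC ?_
  rw [one_le_div (by positivity)]
  linarith

lemma posSemidef_one_sub_mul_kernel [∀ i, (T i).LocallyFinite]
    [∀ i, (T i).FiniteBranchingIndex] (a : ℕ) [NeZero a] (I : IndexingSystem T) (k : Fin d) :
    (Matrix.of fun z w => (1 - UnitBall.coord k z * conj (UnitBall.coord k w)) •
      kernel a I z w).PosSemidef := by
  have h : (Matrix.of fun z w => (1 - UnitBall.coord k z * conj (UnitBall.coord k w)) •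
      kernel a I z w) = ∑ F : Finset (Fin d),
      ∑ u ∈ (finite_solutionSpaceIn_ne_bot a I F).toFinset,
        Matrix.of fun z w => (∑' α : Fin d → ℕ, ((kernelCoeff T a u α -
          (if α k = 0 then 0 else kernelCoeff T a u (α - Pi.single k 1)) : ℝ) : ℂ) *
          (monomial α z * conj (monomial α w))) • (solutionSpaceIn T a u F).starProjection := by
    ext1 z w
    simp only [kernel_eq_sum, Matrix.sum_apply, Matrix.of_apply, Finset.smul_sum, smul_smul,
      one_sub_mul_scalarKernel]
  have h0 : ∀ (u : ∀ i, V i) α, 0 ≤ kernelCoeff T a u α -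
      (if α k = 0 then 0 else kernelCoeff T a u (α - Pi.single k 1)) := fun u α =>
    sub_nonneg.2 (kernelCoeff_sub_single_le a u k α)
  rw [h]
  refine Matrix.posSemidef_sum _ fun F _ => Matrix.posSemidef_sum _ fun u _ => ?_
  refine posSemidef_diagonal _ _ (h0 u) (summable_scalarKernel T a u _ (h0 u) fun α => ?_)
  refine sub_le_self _ ?_
  split_ifs
  · exact le_rfl
  · exact kernelCoeff_nonneg T a u _

variable [∀ i, (T i).LocallyFinite] [∀ i, (T i).FiniteBranchingIndex]

/-- The Drury-Arveson-type space `ℋ_{𝔠_a}(𝒯)`: the reproducing kernel Hilbert space of `E`-valued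
functions on the open unit ball with reproducing kernel `kernel a I`. -/
abbrev DruryArveson (a : ℕ) [NeZero a] (I : IndexingSystem T) := RKHS.OfKernel (kernel a I)

lemma exists_mulCoord (a : ℕ) [NeZero a] (I : IndexingSystem T) (k : Fin d) :
    ∃ M : DruryArveson a I →L[ℂ] DruryArveson a I,
      ∀ f z, M f z = UnitBall.coord k z • f z := by
  refine exists_mul_of_posSemidef _ ?_
  rw [RKHS.OfKernel.kernel_ofKernel]
  exact posSemidef_one_sub_mul_kernel a I k

/-- The operator `ℳ_{z_k}` of multiplication by the `k`-th coordinate function. -/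
def mulCoord (a : ℕ) [NeZero a] (I : IndexingSystem T) (k : Fin d) :
    DruryArveson a I →L[ℂ] DruryArveson a I := (exists_mulCoord a I k).choose

lemma mulCoord_apply (a : ℕ) [NeZero a] (I : IndexingSystem T) (k : Fin d)
    (f : DruryArveson a I) (z : UnitBall d) :
    mulCoord a I k f z = UnitBall.coord k z • f z := (exists_mulCoord a I k).choose_spec f z

/-! ### Constant functions -/

/-- The centre of the unit ball. -/
def UnitBall.zero {d : ℕ} : UnitBall d := ⟨0, by simp⟩

/-- The embedding of `E` into `ℋ_{𝔠_a}(𝒯)` as the subspace of constant functions: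
`f ∈ E` is sent to the kernel function `κ(·, 0) f`, which is the constant function with value `f`. -/
def constFn (a : ℕ) [NeZero a] (I : IndexingSystem T) : jointKernel T a →L[ℂ] DruryArveson a I :=
  RKHS.kerFun (DruryArveson a I) UnitBall.zero

open Classical in
lemma constFn_apply (a : ℕ) [NeZero a] (I : IndexingSystem T) (f : jointKernel T a)
    (z : UnitBall d) : constFn a I f z = f := by
  rw [constFn, RKHS.kerFun_apply, RKHS.OfKernel.kernel_ofKernel, kernel_eq_sum]
  ext w
  simp only [scalarKernel_zero T a _ z UnitBall.zero rfl, one_smul]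
  simp only [sum_apply]
  let ev : jointKernel T a →ₗ[ℂ] ℂ :=
    { toFun := fun g => g.1 w, map_add' := fun _ _ => rfl, map_smul' := fun _ _ => rfl }
  change ev _ = ev f
  simp only [map_sum]
  have hev : ∀ F (u : I.Ω F), ev ((solutionSpaceIn T a u F).starProjection f) =
      if w ∈ sib T F u.1 then f.1 w else 0 := fun F u =>
    starProjection_apply T a u F (I.subset_Phi F u.2) f w
  let F₀ : Finset (Fin d) := Finset.univ.filter fun i => w i ≠ (T i).root
  have hF₀ : w ∈ Phi T F₀ := fun i => by simp [F₀]
  obtain ⟨u₀, ⟨hu₀, hwu⟩, huniq⟩ := I.existsUnique_mem F₀ w hF₀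
  have hsib : ∀ F (u : I.Ω F), w ∈ sib T F u.1 → F = F₀ := by
    intro F u hu
    have hu' := I.subset_Phi F u.2
    ext i
    rw [← hF₀ i]
    constructor
    · intro hi h
      exact (T i).not_adj_root _ (h ▸ (hu.2 i hi).2)
    · intro h
      by_contra hi
      rw [hu.1 i hi] at h
      exact hi ((hu' i).1 h)
  rw [Finset.sum_eq_single F₀, Finset.sum_eq_single ⟨u₀, hu₀⟩]
  · rw [hev, if_pos hwu]; rfl
  · intro u _ hne
    rw [hev, if_neg]
    intro h
    exact hne (Subtype.ext (huniq u.1 ⟨u.2, h⟩))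
  · intro h
    have hbot : solutionSpaceIn T a u₀ F₀ = ⊥ := by simpa using h
    simp [hbot]
  · intro F _ hF
    refine Finset.sum_eq_zero fun u _ => ?_
    rw [hev, if_neg]
    intro h; exact hF (hsib F u h)
  · simp

variable (T) in
open Classical in
/-- The indicator function `e_root` of the root. -/
def eRootFun : ℓ²((∀ i, V i), ℂ) := lp.single 2 (root T) (1 : ℂ)

variable (T) in
/-- `e_root` as an element of `E`. -/
def eRoot (a : ℕ) : jointKernel T a := ⟨eRootFun T, by
  classical
  rw [mem_jointKernel_iff]
  refine fun j v => finsum_mem_eq_zero_of_forall_eq_zero fun w hw => ?_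
  have hne : w ≠ root T := fun h => ((mem_childrenAt_iff T j v w).1 hw).1 (by rw [h]; rfl)
  simp [eRootFun, hne]⟩

/-- A Hilbert module isomorphism: a unitary map intertwining the multiplication operators by the
coordinate functions. -/
def IsHilbertModuleIso {V₁ V₂ : Fin d → Type*} {T₁ : ∀ i, RootedDirectedTree (V₁ i)}
    {T₂ : ∀ i, RootedDirectedTree (V₂ i)}
    [∀ i, (T₁ i).LocallyFinite] [∀ i, (T₁ i).FiniteBranchingIndex]
    [∀ i, (T₂ i).LocallyFinite] [∀ i, (T₂ i).FiniteBranchingIndex]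
    {a : ℕ} [NeZero a] {I₁ : IndexingSystem T₁} {I₂ : IndexingSystem T₂}
    (U : DruryArveson a I₁ ≃ₗᵢ[ℂ] DruryArveson a I₂) : Prop :=
  ∀ k f, U (mulCoord a I₁ k f) = mulCoord a I₂ k (U f)

/-- The direct sum of the spaces `𝓛_{u,F}` over all `u ∈ Ω_F` with `𝖽_u = α`, as a space of constant
functions in `ℋ_{𝔠_a}(𝒯)`. There are only finitely many such `u`, and the spaces `𝓛_{u,F}` are
finite dimensional and mutually orthogonal, so the orthogonal direct sum is the sum of subspaces. -/
def levelSpace (a : ℕ) [NeZero a] (I : IndexingSystem T) (α : Fin d → ℕ) (F : Finset (Fin d)) :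
    Submodule ℂ (DruryArveson a I) :=
  ⨆ u ∈ {u | u ∈ I.Ω F ∧ depth T u = α},
    (solutionSpaceIn T a u F).map (constFn a I).toLinearMap

end TreeProduct

end

/-
The constant functions are the joint kernel of the adjoints of the `ℳ_{z_k}`, so `U` maps the
constant `g` to a constant `W g`, with `W : E₁ → E₂` unitary, and then `z^α g` to `z^α W g`. Write
the kernel as `∑_α z^α conj(w)^α C_α`. Since `⟪z^α C_α f, z^α g⟫ = ⟪f, g⟫`, the map `W` intertwines
the coefficients `C_α` of the two spaces. On a vector supported in depth `n`, the operator `C_α` is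
multiplication by `n! / (n + α)! ∏_{j < |α|} (|n| + a + j)`, and the values at `α = e_k, 2 e_k`
already determine `n` unless `a d = 1`. Hence `W` respects depths. Finally, `F` can be read off from
`n`, as `Φ_F` consists of the vertices whose depth has support `F`, and the vectors supported in
depth `0` are the multiples of `e_root`.
-/

noncomputable section

open scoped ComplexConjugate ComplexOrder InnerProductSpace Nat Ring lp

namespace TreeProduct

/-! ### Power series on the ball -/

lemma eq_zero_of_hasSum_smul_orthonormal {𝕜 E ι : Type*} [RCLike 𝕜] [NormedAddCommGroup E]
    [InnerProductSpace 𝕜 E] {v : ι → E} (hv : Orthonormal 𝕜 v) {c : ι → 𝕜}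
    (hc : HasSum (fun i => c i • v i) 0) : c = 0 := by
  classical
  funext j
  have h := hc.mapL (innerSL 𝕜 (v j))
  simp only [map_smul, innerSL_apply_apply, map_zero, orthonormal_iff_ite.1 hv] at h
  simpa using (hasSum_single j fun i hi => by rw [if_neg hi.symm, smul_zero]).unique h

lemma eq_zero_of_hasSum_smul_mFourier {ι κ : Type*} [Fintype κ] {e : ι → κ → ℤ}
    (he : Function.Injective e) {c : ι → ℂ}
    (hc : HasSum (fun i => c i • UnitAddTorus.mFourier (e i)) 0) : c = 0 := by
  let _ : MeasureTheory.MeasureSpace UnitAddCircle := ⟨AddCircle.haarAddCircle⟩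
  have : MeasureTheory.IsProbabilityMeasure
      (MeasureTheory.volume : MeasureTheory.Measure UnitAddCircle) :=
    inferInstanceAs (MeasureTheory.IsProbabilityMeasure AddCircle.haarAddCircle)
  have h := hc.mapL (ContinuousMap.toLp (E := ℂ) 2
    (MeasureTheory.volume : MeasureTheory.Measure (UnitAddTorus κ)) ℂ)
  simp only [map_smul, map_zero] at h
  exact eq_zero_of_hasSum_smul_orthonormal (UnitAddTorus.orthonormal_mFourier.comp e he) h

/-- The point of the ball with coordinates `t_i / (d + 1)`: the ball contains this scaled copy of
the torus, on which power series become Fourier series. -/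
def torusPoint {d : ℕ} (t : UnitAddTorus (Fin d)) : UnitBall d :=
  ⟨WithLp.toLp 2 fun i => ((d + 1 : ℝ)⁻¹ : ℝ) * ((t i).toCircle : ℂ), by
    have hsq : ∀ i, ‖(((d + 1 : ℝ)⁻¹ : ℝ) : ℂ) * ((t i).toCircle : ℂ)‖ ^ 2 =
        (d + 1 : ℝ)⁻¹ ^ 2 := fun i => by
      rw [norm_mul, Complex.norm_real, Circle.norm_coe, mul_one,
        Real.norm_of_nonneg (by positivity)]
    rw [mem_ball_zero_iff, EuclideanSpace.norm_eq, Real.sqrt_lt' one_pos]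
    simp only [hsq, Finset.sum_const, Finset.card_univ, Fintype.card_fin, nsmul_eq_mul]
    rw [inv_pow, ← div_eq_mul_inv, div_lt_iff₀ (by positivity)]
    nlinarith [d.cast_nonneg (α := ℝ)]⟩

lemma monomial_torusPoint {d : ℕ} (α : Fin d → ℕ) (t : UnitAddTorus (Fin d)) :
    monomial α (torusPoint t) = (((d + 1 : ℝ)⁻¹ ^ ∑ i, α i : ℝ) : ℂ) *
      UnitAddTorus.mFourier (fun i => (α i : ℤ)) t := by
  simp only [monomial, torusPoint, UnitBall.coord, mul_pow, Finset.prod_mul_distrib,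
    Finset.prod_pow_eq_pow_sum, UnitAddTorus.mFourier, ContinuousMap.coe_mk, fourier_apply,
    natCast_zsmul, AddCircle.toCircle_nsmul, Circle.coe_pow, Complex.ofReal_pow]

lemma eq_zero_of_hasSum_monomial {d : ℕ} {s : (Fin d → ℕ) → ℂ}
    (hs : ∀ z : UnitBall d, HasSum (fun α => s α * monomial α z) 0) : s = 0 := by
  let r : (Fin d → ℕ) → ℂ := fun α => (((d + 1 : ℝ)⁻¹ ^ ∑ i, α i : ℝ) : ℂ)
  let e : (Fin d → ℕ) → C(UnitAddTorus (Fin d), ℂ) := fun α =>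
    UnitAddTorus.mFourier fun i => (α i : ℤ)
  have hr : ∀ α, r α ≠ 0 := fun α => Complex.ofReal_ne_zero.2 (by positivity)
  have heval : ∀ t, HasSum (fun α => (s α * r α) • e α t) 0 := fun t =>
    (hs (torusPoint t)).congr_fun fun α => by rw [monomial_torusPoint, ← mul_assoc, smul_eq_mul]
  have hsum : Summable fun α => (s α * r α) • e α := by
    refine .of_norm ((heval 0).summable.norm.congr fun α => ?_)
    rw [norm_smul, norm_smul, UnitAddTorus.mFourier_norm]
    simp [e, UnitAddTorus.mFourier]
  have hzero : ∑' α, (s α * r α) • e α = 0 := ContinuousMap.ext fun t =>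
    (hsum.hasSum.mapL (ContinuousMap.evalCLM ℂ t)).unique (heval t)
  have hcoeff := eq_zero_of_hasSum_smul_mFourier
    (fun α β h => funext fun i => Int.ofNat_inj.1 (congrFun h i)) (hzero ▸ hsum.hasSum)
  exact funext fun α => (mul_eq_zero.1 (congrFun hcoeff α)).resolve_right (hr α)

/-! ### Reproducing kernel Hilbert spaces of power series -/

lemma denseRange_lsum {𝕜 X V K : Type*} [RCLike 𝕜] [AddCommGroup V] [Module 𝕜 V]
    [SeminormedAddCommGroup K] [NormedSpace 𝕜 K] {Φ : X → V →ₗ[𝕜] K}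
    (h : (Submodule.span 𝕜 {Φ x v | (x) (v)}).topologicalClosure = ⊤) :
    DenseRange (Finsupp.lsum 𝕜 Φ) := by
  have hle : Submodule.span 𝕜 {Φ x v | (x) (v)} ≤ LinearMap.range (Finsupp.lsum 𝕜 Φ) := by
    rw [Submodule.span_le]
    rintro _ ⟨x, v, rfl⟩
    exact ⟨.single x v, Finsupp.lsum_single ..⟩
  rw [DenseRange, ← LinearMap.coe_range, Submodule.dense_iff_topologicalClosure_eq_top]
  exact top_unique (h.symm.le.trans (Submodule.topologicalClosure_mono hle))

lemma exists_linearIsometryEquiv_kerFun {𝕜 X V H K : Type*} [RCLike 𝕜]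
    [NormedAddCommGroup V] [InnerProductSpace 𝕜 V] [CompleteSpace V]
    [NormedAddCommGroup H] [InnerProductSpace 𝕜 H] [CompleteSpace H] [RKHS 𝕜 H X V]
    [NormedAddCommGroup K] [InnerProductSpace 𝕜 K] [CompleteSpace K] (Φ : X → V →ₗ[𝕜] K)
    (hΦ : ∀ x y v w, ⟪Φ x v, Φ y w⟫_𝕜 = ⟪v, RKHS.kernel H x y w⟫_𝕜)
    (htotal : (Submodule.span 𝕜 {Φ x v | (x) (v)}).topologicalClosure = ⊤) :
    ∃ L : K ≃ₗᵢ[𝕜] H, ∀ x v, L (Φ x v) = RKHS.kerFun H x v := by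
  let κ : X → V →ₗ[𝕜] H := fun x => (RKHS.kerFun H x).toLinearMap
  have hinner : ∀ f : X →₀ V,
      ⟪Finsupp.lsum 𝕜 κ f, Finsupp.lsum 𝕜 κ f⟫_𝕜 = ⟪Finsupp.lsum 𝕜 Φ f, Finsupp.lsum 𝕜 Φ f⟫_𝕜 :=
    fun f => by
      simp only [κ, Finsupp.lsum_apply, Finsupp.sum, sum_inner, inner_sum, hΦ,
        ContinuousLinearMap.coe_coe, RKHS.kerFun_inner, RKHS.kerFun_apply]
  have hnorm : ∀ f, ‖Finsupp.lsum 𝕜 κ f‖ = ‖Finsupp.lsum 𝕜 Φ f‖ := fun f => by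
    rw [norm_eq_sqrt_re_inner (𝕜 := 𝕜), hinner, ← norm_eq_sqrt_re_inner]
  obtain ⟨L, hL⟩ : ∃ L : K ≃ₗᵢ[𝕜] H, ∀ f, L (Finsupp.lsum 𝕜 Φ f) = Finsupp.lsum 𝕜 κ f :=
    ⟨_, LinearEquiv.extendOfIsometry_eq (LinearEquiv.refl 𝕜 _) _ _ (denseRange_lsum htotal)
      (denseRange_lsum (RKHS.kerFun_dense H)) hnorm⟩
  refine ⟨L, fun x v => ?_⟩
  rw [← Finsupp.lsum_single 𝕜 Φ, hL, Finsupp.lsum_single, ContinuousLinearMap.coe_coe]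

section PowerSeriesKernel

variable {d : ℕ} {E H : Type*}
  [NormedAddCommGroup E] [InnerProductSpace ℂ E] [CompleteSpace E]
  [NormedAddCommGroup H] [InnerProductSpace ℂ H] [CompleteSpace H] [RKHS ℂ H (UnitBall d) E]
  {C : (Fin d → ℕ) → E →L[ℂ] E}

lemma inner_sqrt_left (A : E →L[ℂ] E) (f g : E) :
    ⟪CFC.sqrt A f, g⟫_ℂ = ⟪f, CFC.sqrt A g⟫_ℂ :=
  (IsSelfAdjoint.of_nonneg (CFC.sqrt_nonneg A)).isSymmetric f g

variable (H C) in
/-- `H` is a space of `E`-valued functions on the ball with reproducing kernel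
`∑_α z^α conj(w)^α C_α`, where the coefficients `C_α` are positive and invertible and `C_0 = 1`. -/
structure HasPowerSeriesKernel : Prop where
  isStrictlyPositive : ∀ α, IsStrictlyPositive (C α)
  coeff_zero : C 0 = 1
  hasSum_kernel : ∀ z w g,
    HasSum (fun α => (monomial α z * conj (monomial α w)) • C α g) (RKHS.kernel H z w g)

namespace HasPowerSeriesKernel

variable (hH : HasPowerSeriesKernel H C)
include hH

lemma sqrt_sqrt_apply (α : Fin d → ℕ) (g : E) : CFC.sqrt (C α) (CFC.sqrt (C α) g) = C α g :=
  DFunLike.congr_fun (CFC.sqrt_mul_sqrt_self (C α) (hH.isStrictlyPositive α).nonneg) g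

lemma inner_monomial_smul_sqrt (z w : UnitBall d) (f g : E) (α : Fin d → ℕ) :
    ⟪conj (monomial α z) • CFC.sqrt (C α) f, conj (monomial α w) • CFC.sqrt (C α) g⟫_ℂ =
      ⟪f, (monomial α z * conj (monomial α w)) • C α g⟫_ℂ := by
  rw [inner_smul_left, inner_smul_right, inner_smul_right, inner_sqrt_left, RCLike.conj_conj,
    mul_assoc, hH.sqrt_sqrt_apply]

lemma hasSum_inner_monomial_smul_sqrt (z w : UnitBall d) (f g : E) :
    HasSum (fun α => ⟪conj (monomial α z) • CFC.sqrt (C α) f,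
      conj (monomial α w) • CFC.sqrt (C α) g⟫_ℂ) ⟪f, RKHS.kernel H z w g⟫_ℂ := by
  simp only [hH.inner_monomial_smul_sqrt]
  exact (hH.hasSum_kernel z w g).mapL (innerSL ℂ f)

lemma memℓp_monomial_smul_sqrt (z : UnitBall d) (g : E) :
    Memℓp (fun α => conj (monomial α z) • CFC.sqrt (C α) g) 2 := by
  refine memℓp_gen ((hH.hasSum_inner_monomial_smul_sqrt z z g g).summable.norm.congr fun α => ?_)
  simp [inner_self_eq_norm_sq_to_K]

/-- The vectors `(conj(z)^α C_α^{1/2} g)_α`, whose Gram operators are the values of the kernel. -/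
def featureMap (z : UnitBall d) : E →ₗ[ℂ] ℓ²(Fin d → ℕ, E) where
  toFun g := ⟨_, hH.memℓp_monomial_smul_sqrt z g⟩
  map_add' f g := lp.ext (funext fun _ => (congrArg _ (map_add _ f g)).trans (smul_add _ _ _))
  map_smul' c g := lp.ext (funext fun _ => (congrArg _ (map_smul _ c g)).trans (smul_comm _ _ _))

lemma featureMap_apply (z : UnitBall d) (g : E) (α : Fin d → ℕ) :
    hH.featureMap z g α = conj (monomial α z) • CFC.sqrt (C α) g := rfl

lemma inner_featureMap (z w : UnitBall d) (f g : E) :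
    ⟪hH.featureMap z f, hH.featureMap w g⟫_ℂ = ⟪f, RKHS.kernel H z w g⟫_ℂ :=
  (lp.hasSum_inner _ _).unique (hH.hasSum_inner_monomial_smul_sqrt z w f g)

lemma isUnit_sqrt (α : Fin d → ℕ) : IsUnit (CFC.sqrt (C α)) :=
  CFC.isUnit_sqrt_iff_isStrictlyPositive.2 (hH.isStrictlyPositive α)

lemma sqrt_inverse_apply (α : Fin d → ℕ) (g : E) :
    CFC.sqrt (C α) ((CFC.sqrt (C α))⁻¹ʳ g) = g :=
  DFunLike.congr_fun (Ring.mul_inverse_cancel _ (hH.isUnit_sqrt α)) g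

lemma inverse_sqrt_apply (α : Fin d → ℕ) (g : E) :
    (CFC.sqrt (C α))⁻¹ʳ (CFC.sqrt (C α) g) = g :=
  DFunLike.congr_fun (Ring.inverse_mul_cancel _ (hH.isUnit_sqrt α)) g

lemma eq_zero_of_inner_featureMap {k : ℓ²(Fin d → ℕ, E)}
    (hk : ∀ z g, ⟪hH.featureMap z g, k⟫_ℂ = 0) : k = 0 := by
  have hcoeff : ∀ g, (fun α => ⟪g, CFC.sqrt (C α) (k α)⟫_ℂ) = 0 := fun g =>
    eq_zero_of_hasSum_monomial fun z => by
      rw [← hk z g]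
      refine (lp.hasSum_inner (hH.featureMap z g) k).congr_fun fun α => ?_
      rw [featureMap_apply, inner_smul_left, RCLike.conj_conj, inner_sqrt_left, mul_comm]
  refine lp.ext (funext fun α => ?_)
  have hsqrt : CFC.sqrt (C α) (k α) = 0 := ext_inner_left ℂ fun g => by
    rw [inner_zero_right]; exact congrFun (hcoeff g) α
  rw [← hH.inverse_sqrt_apply α (k α), hsqrt, map_zero]
  rfl

lemma topologicalClosure_span_featureMap :
    (Submodule.span ℂ {hH.featureMap z g | (z) (g)}).topologicalClosure = ⊤ := by
  rw [Submodule.topologicalClosure_eq_top_iff, Submodule.eq_bot_iff]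
  exact fun k hk => hH.eq_zero_of_inner_featureMap fun z g =>
    hk _ (Submodule.subset_span ⟨z, g, rfl⟩)

/-- The unitary map from square-summable sequences in `E` to `H` which sends the feature vectors to
the kernel functions. -/
def modelIso : ℓ²(Fin d → ℕ, E) ≃ₗᵢ[ℂ] H :=
  (exists_linearIsometryEquiv_kerFun hH.featureMap hH.inner_featureMap
    hH.topologicalClosure_span_featureMap).choose

lemma modelIso_featureMap (z : UnitBall d) (g : E) :
    hH.modelIso (hH.featureMap z g) = RKHS.kerFun H z g :=
  (exists_linearIsometryEquiv_kerFun hH.featureMap hH.inner_featureMap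
    hH.topologicalClosure_span_featureMap).choose_spec z g

lemma modelIso_single_apply (α : Fin d → ℕ) (g : E) (z : UnitBall d) :
    hH.modelIso (lp.single 2 α g) z = monomial α z • CFC.sqrt (C α) g :=
  ext_inner_left ℂ fun f => by
    rw [← RKHS.kerFun_inner, ← hH.modelIso_featureMap, LinearIsometryEquiv.inner_map_map,
      lp.inner_single_right, featureMap_apply, inner_smul_left, inner_smul_right, RCLike.conj_conj,
      inner_sqrt_left]

/-- The function `z ↦ z^α g`, as an element of `H`. -/
def monomialFn (α : Fin d → ℕ) : E →ₗ[ℂ] H :=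
  hH.modelIso.toLinearEquiv.toLinearMap ∘ₗ lp.lsingle 2 α ∘ₗ
    ((CFC.sqrt (C α))⁻¹ʳ).toLinearMap

lemma monomialFn_def (α : Fin d → ℕ) (g : E) :
    hH.monomialFn α g = hH.modelIso (lp.single 2 α ((CFC.sqrt (C α))⁻¹ʳ g)) := rfl

lemma monomialFn_apply (α : Fin d → ℕ) (g : E) (z : UnitBall d) :
    hH.monomialFn α g z = monomial α z • g := by
  rw [monomialFn_def, modelIso_single_apply, hH.sqrt_inverse_apply]

lemma inner_monomialFn_coeff (α : Fin d → ℕ) (f g : E) :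
    ⟪hH.monomialFn α (C α f), hH.monomialFn α g⟫_ℂ = ⟪f, g⟫_ℂ := by
  rw [monomialFn_def, monomialFn_def, LinearIsometryEquiv.inner_map_map, lp.inner_single_right,
    lp.single_apply_self, ← hH.sqrt_sqrt_apply, hH.inverse_sqrt_apply, inner_sqrt_left,
    hH.sqrt_inverse_apply]

lemma monomialFn_injective (α : Fin d → ℕ) : Function.Injective (hH.monomialFn α) := by
  refine (injective_iff_map_eq_zero _).2 fun g hg => ?_
  rw [← inner_self_eq_zero (𝕜 := ℂ), ← hH.inner_monomialFn_coeff α, hg, inner_zero_right]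

lemma eq_zero_of_inner_monomialFn {x : H} (hx : ∀ α g, ⟪x, hH.monomialFn α g⟫_ℂ = 0) : x = 0 := by
  obtain ⟨y, rfl⟩ := hH.modelIso.surjective x
  refine (map_eq_zero_iff _ hH.modelIso.injective).2 (lp.ext (funext fun α => ?_))
  refine ext_inner_right ℂ fun g => ?_
  have h := hx α (CFC.sqrt (C α) g)
  rw [monomialFn_def, LinearIsometryEquiv.inner_map_map, hH.inverse_sqrt_apply,
    lp.inner_single_right] at h
  rw [h, lp.coeFn_zero, Pi.zero_apply, inner_zero_left]

end HasPowerSeriesKernel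

lemma monomial_zero (z : UnitBall d) : monomial 0 z = 1 := by simp [monomial]

lemma monomial_add_single (α : Fin d → ℕ) (k : Fin d) (z : UnitBall d) :
    monomial (α + Pi.single k 1) z = UnitBall.coord k z * monomial α z := by
  have hk : ∏ i, UnitBall.coord i z ^ (Pi.single k 1 : Fin d → ℕ) i = UnitBall.coord k z := by
    rw [Finset.prod_eq_single k] <;> simp +contextual
  simp only [monomial, Pi.add_apply, pow_add, Finset.prod_mul_distrib, hk, mul_comm]

lemma exists_eq_add_single {α : Fin d → ℕ} (hα : α ≠ 0) :
    ∃ (β : Fin d → ℕ) (k : Fin d), α = β + Pi.single k 1 := by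
  obtain ⟨k, hk⟩ := Function.ne_iff.1 hα
  have hle : Pi.single k 1 ≤ α := fun i => by
    obtain rfl | hi := eq_or_ne i k
    · rw [Pi.single_eq_same]
      exact Nat.one_le_iff_ne_zero.2 hk
    · rw [Pi.single_eq_of_ne hi]
      exact Nat.zero_le _
  exact ⟨α - Pi.single k 1, k, (tsub_add_cancel_of_le hle).symm⟩

lemma multiIndex_induction {P : (Fin d → ℕ) → Prop} (zero : P 0)
    (add_single : ∀ α k, P α → P (α + Pi.single k 1)) (α : Fin d → ℕ) : P α := by
  induction α using WellFoundedLT.induction with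
  | ind α ih =>
    obtain rfl | hα := eq_or_ne α 0
    · exact zero
    · obtain ⟨β, k, rfl⟩ := exists_eq_add_single hα
      exact add_single β k (ih β (lt_add_of_pos_right β (Pi.single_pos.2 one_pos)))

lemma monomial_ballZero {α : Fin d → ℕ} (hα : α ≠ 0) : monomial α UnitBall.zero = 0 := by
  obtain ⟨β, k, rfl⟩ := exists_eq_add_single hα
  rw [monomial_add_single]
  exact zero_mul _

/-- `M₁, …, M_d` are the operators of multiplication by the coordinate functions. -/
def IsCoordMul (M : Fin d → H →L[ℂ] H) : Prop :=
  ∀ k f z, M k f z = UnitBall.coord k z • f z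

lemma IsCoordMul.inner_kerFun_zero {M : Fin d → H →L[ℂ] H} (hM : IsCoordMul M) (k : Fin d)
    (g : E) (f : H) : ⟪RKHS.kerFun H UnitBall.zero g, M k f⟫_ℂ = 0 := by
  have h0 : M k f UnitBall.zero = 0 := (hM k f _).trans (zero_smul ℂ _)
  rw [RKHS.kerFun_inner, h0, inner_zero_right]

namespace HasPowerSeriesKernel

variable (hH : HasPowerSeriesKernel H C)
include hH

lemma kerFun_zero_apply (g : E) (z : UnitBall d) : RKHS.kerFun H UnitBall.zero g z = g := by
  have h := (hH.hasSum_kernel z UnitBall.zero g).unique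
    (hasSum_single 0 fun α hα => by rw [monomial_ballZero hα, map_zero, mul_zero, zero_smul])
  rw [RKHS.kerFun_apply, h, monomial_zero, monomial_zero, map_one, mul_one, one_smul, hH.coeff_zero]
  rfl

/-- The embedding of `E` into `H` as the space of constant functions. -/
def constIsometry : E →ₗᵢ[ℂ] H :=
  (RKHS.kerFun H UnitBall.zero).toLinearMap.isometryOfInner fun f g => by
    rw [ContinuousLinearMap.coe_coe, RKHS.kerFun_inner, hH.kerFun_zero_apply]

lemma constIsometry_apply (g : E) (z : UnitBall d) : hH.constIsometry g z = g :=
  hH.kerFun_zero_apply g z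

lemma inner_constIsometry (x : H) (g : E) :
    ⟪x, hH.constIsometry g⟫_ℂ = ⟪x UnitBall.zero, g⟫_ℂ := RKHS.inner_kerFun ..

lemma monomialFn_zero (g : E) : hH.monomialFn 0 g = hH.constIsometry g :=
  RKHS.ext fun z => by
    rw [hH.monomialFn_apply, monomial_zero, one_smul, hH.constIsometry_apply]

lemma coordMul_monomialFn {M : Fin d → H →L[ℂ] H} (hM : IsCoordMul M) (k : Fin d)
    (α : Fin d → ℕ) (g : E) : M k (hH.monomialFn α g) = hH.monomialFn (α + Pi.single k 1) g :=
  RKHS.ext fun z => by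
    rw [hM, hH.monomialFn_apply, hH.monomialFn_apply, monomial_add_single, mul_smul]

lemma mem_range_constIsometry {M : Fin d → H →L[ℂ] H} (hM : IsCoordMul M) {x : H} :
    x ∈ LinearMap.range hH.constIsometry.toLinearMap ↔ ∀ k f, ⟪x, M k f⟫_ℂ = 0 := by
  refine ⟨?_, fun hx => ⟨x UnitBall.zero, ?_⟩⟩
  · rintro ⟨g, rfl⟩ k f
    exact hM.inner_kerFun_zero k g f
  · refine (sub_eq_zero.1 (hH.eq_zero_of_inner_monomialFn fun α g => ?_)).symm
    obtain rfl | hα := eq_or_ne α 0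
    · rw [hH.monomialFn_zero, hH.inner_constIsometry, RKHS.coe_sub, Pi.sub_apply]
      exact (congrArg (⟪·, g⟫_ℂ) (sub_eq_zero.2 (hH.constIsometry_apply _ _).symm)).trans
        (inner_zero_left g)
    · obtain ⟨β, k, rfl⟩ := exists_eq_add_single hα
      rw [← hH.coordMul_monomialFn hM, inner_sub_left, hx, zero_sub, neg_eq_zero]
      exact hM.inner_kerFun_zero k _ _

lemma eq_coeff_of_inner_monomialFn {α : Fin d → ℕ} {f x : E}
    (h : ∀ g, ⟪hH.monomialFn α x, hH.monomialFn α g⟫_ℂ = ⟪f, g⟫_ℂ) : x = C α f := by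
  refine sub_eq_zero.1 ((map_eq_zero_iff _ (hH.monomialFn_injective α)).1 ?_)
  rw [← inner_self_eq_zero (𝕜 := ℂ)]
  nth_rw 1 [map_sub]
  rw [inner_sub_left, h, hH.inner_monomialFn_coeff, sub_self]

end HasPowerSeriesKernel

lemma exists_linearIsometryEquiv_of_map_range {𝕜 E₁ E₂ H₁ H₂ : Type*} [NormedField 𝕜]
    [NormedAddCommGroup E₁] [NormedSpace 𝕜 E₁] [NormedAddCommGroup E₂] [NormedSpace 𝕜 E₂]
    [NormedAddCommGroup H₁] [NormedSpace 𝕜 H₁] [NormedAddCommGroup H₂] [NormedSpace 𝕜 H₂]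
    {J₁ : E₁ →ₗᵢ[𝕜] H₁} {J₂ : E₂ →ₗᵢ[𝕜] H₂} {U : H₁ ≃ₗᵢ[𝕜] H₂}
    (hU : (LinearMap.range J₁.toLinearMap).map U.toLinearEquiv.toLinearMap =
      LinearMap.range J₂.toLinearMap) :
    ∃ W : E₁ ≃ₗᵢ[𝕜] E₂, ∀ g, U (J₁ g) = J₂ (W g) := by
  let e := J₁.equivRange.trans
    ((U.submoduleMap _).trans (LinearIsometryEquiv.ofEq _ (LinearMap.range J₂.toLinearMap) hU))
  refine ⟨e.trans J₂.equivRange.symm, fun g => ?_⟩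
  exact (congrArg Subtype.val (J₂.equivRange.apply_symm_apply (e g))).symm

variable {E₁ E₂ H₁ H₂ : Type*}
  [NormedAddCommGroup E₁] [InnerProductSpace ℂ E₁] [CompleteSpace E₁]
  [NormedAddCommGroup H₁] [InnerProductSpace ℂ H₁] [CompleteSpace H₁] [RKHS ℂ H₁ (UnitBall d) E₁]
  [NormedAddCommGroup E₂] [InnerProductSpace ℂ E₂] [CompleteSpace E₂]
  [NormedAddCommGroup H₂] [InnerProductSpace ℂ H₂] [CompleteSpace H₂] [RKHS ℂ H₂ (UnitBall d) E₂]
  {C₁ : (Fin d → ℕ) → E₁ →L[ℂ] E₁} {C₂ : (Fin d → ℕ) → E₂ →L[ℂ] E₂}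
  {M₁ : Fin d → H₁ →L[ℂ] H₁} {M₂ : Fin d → H₂ →L[ℂ] H₂} {U : H₁ ≃ₗᵢ[ℂ] H₂}

namespace HasPowerSeriesKernel

lemma map_range_constIsometry (hH₁ : HasPowerSeriesKernel H₁ C₁)
    (hH₂ : HasPowerSeriesKernel H₂ C₂) (hM₁ : IsCoordMul M₁) (hM₂ : IsCoordMul M₂)
    (hU : ∀ k f, U (M₁ k f) = M₂ k (U f)) :
    (LinearMap.range hH₁.constIsometry.toLinearMap).map U.toLinearEquiv.toLinearMap =
      LinearMap.range hH₂.constIsometry.toLinearMap := by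
  ext x
  obtain ⟨y, rfl⟩ := U.surjective x
  have hmem : U y ∈ (LinearMap.range hH₁.constIsometry.toLinearMap).map
      U.toLinearEquiv.toLinearMap ↔ y ∈ LinearMap.range hH₁.constIsometry.toLinearMap :=
    U.injective.mem_set_image
  rw [hmem, hH₁.mem_range_constIsometry hM₁, hH₂.mem_range_constIsometry hM₂]
  simp only [U.surjective.forall, ← hU, U.inner_map_map]

lemma map_monomialFn (hH₁ : HasPowerSeriesKernel H₁ C₁) (hH₂ : HasPowerSeriesKernel H₂ C₂)
    (hM₁ : IsCoordMul M₁) (hM₂ : IsCoordMul M₂) (hU : ∀ k f, U (M₁ k f) = M₂ k (U f))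
    {W : E₁ → E₂} (hW : ∀ g, U (hH₁.constIsometry g) = hH₂.constIsometry (W g))
    (α : Fin d → ℕ) (g : E₁) : U (hH₁.monomialFn α g) = hH₂.monomialFn α (W g) := by
  induction α using multiIndex_induction with
  | zero => rw [monomialFn_zero, monomialFn_zero, hW]
  | add_single α k ih => rw [← hH₁.coordMul_monomialFn hM₁, ← hH₂.coordMul_monomialFn hM₂, hU, ih]

theorem exists_linearIsometryEquiv_coeff (hH₁ : HasPowerSeriesKernel H₁ C₁)
    (hH₂ : HasPowerSeriesKernel H₂ C₂) (hM₁ : IsCoordMul M₁) (hM₂ : IsCoordMul M₂)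
    (hU : ∀ k f, U (M₁ k f) = M₂ k (U f)) :
    ∃ W : E₁ ≃ₗᵢ[ℂ] E₂,
      (∀ g, U (RKHS.kerFun H₁ UnitBall.zero g) = RKHS.kerFun H₂ UnitBall.zero (W g)) ∧
      ∀ α g, W (C₁ α g) = C₂ α (W g) := by
  obtain ⟨W, hW⟩ :=
    exists_linearIsometryEquiv_of_map_range (map_range_constIsometry hH₁ hH₂ hM₁ hM₂ hU)
  refine ⟨W, hW, fun α f => hH₂.eq_coeff_of_inner_monomialFn (W.surjective.forall.2 fun g => ?_)⟩
  rw [← map_monomialFn hH₁ hH₂ hM₁ hM₂ hU hW, ← map_monomialFn hH₁ hH₂ hM₁ hM₂ hU hW,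
    U.inner_map_map, W.inner_map_map, hH₁.inner_monomialFn_coeff]

end HasPowerSeriesKernel
end PowerSeriesKernel

end TreeProduct

namespace RootedDirectedTree

variable {V : Type*} (T : RootedDirectedTree V)

lemma depth_eq_zero_iff {v : V} : T.depth v = 0 ↔ v = T.root := by
  refine ⟨fun h => ?_, ?_⟩
  · rw [← T.iterate_depth v, h, Function.iterate_zero_apply]
  · rintro rfl
    exact Nat.sInf_eq_zero.2 (Or.inl rfl)

lemma depth_eq_depth_parent_add_one {v : V} (hv : v ≠ T.root) :
    T.depth v = T.depth (T.parent v) + 1 := by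
  refine le_antisymm (Nat.sInf_le (T.iterate_depth (T.parent v))) ?_
  obtain ⟨n, hn⟩ := Nat.exists_eq_succ_of_ne_zero (T.depth_eq_zero_iff.not.2 hv)
  have hroot := T.iterate_depth v
  rw [hn, Function.iterate_succ_apply] at hroot
  exact hn ▸ Nat.succ_le_succ (Nat.sInf_le hroot)

lemma depth_eq_of_mem_siblings {v w : V} (hw : w ∈ T.siblings v) : T.depth w = T.depth v := by
  have hroot : w ≠ T.root := fun h => T.not_adj_root _ (h ▸ hw.2)
  rw [T.depth_eq_depth_parent_add_one hw.1, T.depth_eq_depth_parent_add_one hroot,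
    T.parent_eq hw.2]

end RootedDirectedTree

namespace TreeProduct

section Depth

variable {d : ℕ} {V : Fin d → Type*} {T : ∀ i, RootedDirectedTree (V i)}

lemma depth_eq_zero_iff {v : ∀ i, V i} : depth T v = 0 ↔ v = root T := by
  simp only [funext_iff, depth, root, Pi.zero_apply, RootedDirectedTree.depth_eq_zero_iff]

lemma mem_Phi_iff {F : Finset (Fin d)} {v : ∀ i, V i} :
    v ∈ Phi T F ↔ F = ({i | depth T v i ≠ 0} : Finset (Fin d)) := by
  rw [Finset.ext_iff]
  refine forall_congr' fun i => ?_
  rw [Finset.mem_filter_univ, depth, (T i).depth_eq_zero_iff.ne]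
  exact Iff.comm

lemma depth_eq_of_mem_sib {F : Finset (Fin d)} {u v : ∀ i, V i} (hv : v ∈ sib T F u) :
    depth T v = depth T u := by
  funext i
  by_cases hi : i ∈ F
  · exact (T i).depth_eq_of_mem_siblings (hv.2 i hi)
  · exact congrArg (T i).depth (hv.1 i hi)

lemma existsUnique_mem_sib (I : IndexingSystem T) (v : ∀ i, V i) :
    ∃! p : Σ F, I.Ω F, v ∈ sib T p.1 p.2 := by
  obtain ⟨u, ⟨hu, hv⟩, huniq⟩ := I.existsUnique_mem _ v (mem_Phi_iff.2 rfl)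
  refine ⟨⟨_, u, hu⟩, hv, ?_⟩
  rintro ⟨F, w, hw⟩ hvw
  obtain rfl : F = ({i | depth T v i ≠ 0} : Finset (Fin d)) := by
    rw [depth_eq_of_mem_sib hvw]
    exact mem_Phi_iff.1 (I.subset_Phi F hw)
  obtain rfl := huniq w ⟨hw, hvw⟩
  rfl

end Depth

/-! ### The coefficients of the kernel -/

section DepthCoeff

variable {d : ℕ} (a : ℕ) (n α : Fin d → ℕ)

/-- The coefficient `n! / (n + α)! ∏_{j < |α|} (|n| + a + j)` of `z^α conj(w)^α` in the scalar
kernel of a vertex of depth `n`. -/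
def depthCoeff : ℝ :=
  ((∏ i, (n i)! : ℕ) : ℝ) / ((∏ i, (n i + α i)! : ℕ) : ℝ) *
    ∏ j ∈ Finset.range (∑ i, α i), (((∑ i, n i : ℕ) : ℝ) + a + j)

lemma depthCoeff_zero : depthCoeff a n 0 = 1 := by
  have h : ((∏ i, (n i)! : ℕ) : ℝ) ≠ 0 :=
    Nat.cast_ne_zero.2 (Finset.prod_ne_zero_iff.2 fun i _ => (n i).factorial_ne_zero)
  simp only [depthCoeff, Pi.zero_apply, add_zero, div_self h, Finset.sum_const_zero,
    Finset.range_zero, Finset.prod_empty, mul_one]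

lemma depthCoeff_pos [NeZero a] : 0 < depthCoeff a n α := by
  have ha : (0 : ℝ) < a := Nat.cast_pos.2 (NeZero.pos a)
  unfold depthCoeff
  positivity

lemma prod_factorial_add_single (k : Fin d) :
    ∏ i, ((n + Pi.single k 1 : Fin d → ℕ) i)! = (n k + 1) * ∏ i, (n i)! := by
  have h : ∀ i, ((n + Pi.single k 1 : Fin d → ℕ) i)! = (if i = k then n i + 1 else 1) * (n i)! := by
    intro i
    obtain rfl | hi := eq_or_ne i k
    · simp [Nat.factorial_succ]
    · simp [hi]
  simp only [h, Finset.prod_mul_distrib, Finset.prod_ite_eq', Finset.mem_univ, if_true]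

lemma depthCoeff_add_single (k : Fin d) :
    depthCoeff a n (α + Pi.single k 1) =
      depthCoeff a n α * (((∑ i, n i : ℕ) + a + (∑ i, α i : ℕ)) / (n k + α k + 1)) := by
  have hfact : ∏ i, (n i + (α + Pi.single k 1 : Fin d → ℕ) i)! =
      (n k + α k + 1) * ∏ i, (n i + α i)! := by
    simpa only [Pi.add_apply, add_assoc] using prod_factorial_add_single (n + α) k
  have hsum : ∑ i, (α + Pi.single k 1 : Fin d → ℕ) i = ∑ i, α i + 1 := by
    simp [Finset.sum_add_distrib]
  rw [depthCoeff, depthCoeff, hfact, hsum, Finset.prod_range_succ, Nat.cast_mul, Nat.cast_add_one,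
    Nat.cast_add, mul_comm ((n k : ℝ) + α k + 1), ← div_div]
  ring

lemma depthCoeff_single (k : Fin d) :
    depthCoeff a n (Pi.single k 1) = ((∑ i, n i : ℕ) + a) / (n k + 1) := by
  simpa [depthCoeff_zero] using depthCoeff_add_single a n 0 k

lemma depthCoeff_single_add_single (k : Fin d) :
    depthCoeff a n (Pi.single k 1 + Pi.single k 1) =
      depthCoeff a n (Pi.single k 1) * (((∑ i, n i : ℕ) + a + 1) / (n k + 1 + 1)) := by
  simpa using depthCoeff_add_single a n (Pi.single k 1) k

variable {a n}

lemma eq_of_div_eq_div_of_add_one_div_eq {x y x' y' : ℝ} (hy : 0 < y) (hy' : 0 < y')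
    (h₁ : x / y = x' / y') (h₂ : (x + 1) / (y + 1) = (x' + 1) / (y' + 1)) :
    (x = y ∧ x' = y') ∨ (x = x' ∧ y = y') := by
  rw [div_eq_div_iff hy.ne' hy'.ne'] at h₁
  rw [div_eq_div_iff (by positivity) (by positivity)] at h₂
  have hmul : (x - y) * (y' - y) = 0 := by linear_combination h₁ - y * (h₂ - h₁)
  obtain h | h := mul_eq_zero.1 hmul
  · exact Or.inl ⟨by linarith, by linarith⟩
  · exact Or.inr ⟨by linarith, by linarith⟩

lemma eq_zero_of_sum_add_eq_add_one [NeZero a] (had : a * d ≠ 1)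
    (hn : ∀ k, ∑ i, n i + a = n k + 1) : n = 0 := by
  funext k
  have hle : n k ≤ ∑ i, n i := Finset.single_le_sum (fun i _ => Nat.zero_le _) (Finset.mem_univ k)
  obtain rfl : a = 1 := le_antisymm (by linarith [hn k]) NeZero.one_le
  have hconst : ∀ i, n i = n k := fun i => Nat.succ_injective ((hn i).symm.trans (hn k))
  have hmul : d * n k = 1 * n k := by
    simpa [hconst] using Nat.succ_injective (hn k)
  by_contra h
  exact had (by rw [one_mul, Nat.eq_of_mul_eq_mul_right (Nat.pos_of_ne_zero h) hmul])

lemma eq_of_depthCoeff_eq [NeZero a] (had : a * d ≠ 1) {m : Fin d → ℕ}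
    (h : ∀ α, depthCoeff a n α = depthCoeff a m α) : n = m := by
  have hk : ∀ k, (∑ i, n i + a = n k + 1 ∧ ∑ i, m i + a = m k + 1) ∨
      (∑ i, n i + a = ∑ i, m i + a ∧ n k + 1 = m k + 1) := fun k => by
    have h₁ := h (Pi.single k 1)
    have h₂ := h (Pi.single k 1 + Pi.single k 1)
    rw [depthCoeff_single_add_single, depthCoeff_single_add_single, ← h₁] at h₂
    rw [depthCoeff_single, depthCoeff_single] at h₁
    exact_mod_cast eq_of_div_eq_div_of_add_one_div_eq (by positivity) (by positivity) h₁
      (mul_left_cancel₀ (depthCoeff_pos a n _).ne' h₂)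
  by_cases hsum : ∑ i, n i = ∑ i, m i
  · funext k
    have := hk k
    omega
  · have hcrit := fun k => (hk k).resolve_right fun h => hsum (add_right_cancel h.1)
    rw [eq_zero_of_sum_add_eq_add_one had fun k => (hcrit k).1,
      eq_zero_of_sum_add_eq_add_one had fun k => (hcrit k).2]

end DepthCoeff

/-! ### Operators that are diagonal with respect to the depth -/

section DepthDiag

variable {d : ℕ} {V : Fin d → Type*} {T : ∀ i, RootedDirectedTree (V i)}
  [∀ i, (T i).LocallyFinite] {a : ℕ}

lemma jointKernel_ext {f g : jointKernel T a} (h : ∀ w, f.1 w = g.1 w) : f = g :=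
  Subtype.ext (lp.ext (funext h))

variable (T a) in
/-- The evaluation of the elements of `E` at the vertex `w`. -/
def evalVertex (w : ∀ i, V i) : jointKernel T a →ₗ[ℂ] ℂ where
  toFun f := f.1 w
  map_add' _ _ := rfl
  map_smul' _ _ := rfl

variable (T a) in
/-- The space of all elements of `E` that are supported on the vertices of depth `n`. -/
def depthSpace (n : Fin d → ℕ) : Submodule ℂ (jointKernel T a) :=
  ⨅ (w : ∀ i, V i) (_ : depth T w ≠ n), LinearMap.ker (evalVertex T a w)

lemma mem_depthSpace {n : Fin d → ℕ} {f : jointKernel T a} :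
    f ∈ depthSpace T a n ↔ ∀ w, depth T w ≠ n → f.1 w = 0 := by
  simp only [depthSpace, Submodule.mem_iInf, LinearMap.mem_ker]
  rfl

lemma solutionSpaceIn_le_depthSpace (u : ∀ i, V i) (F : Finset (Fin d)) :
    solutionSpaceIn T a u F ≤ depthSpace T a (depth T u) := fun f hf =>
  mem_depthSpace.2 fun w hw =>
    (show f.1 ∈ solutionSpace T a u F from hf).1 w (mt depth_eq_of_mem_sib hw)

variable [∀ i, (T i).FiniteBranchingIndex] [NeZero a]

variable (a) in
/-- The operator on `E` that acts on each `𝓛_{u,F}` as multiplication by `b (depth T u)`. -/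
def depthDiag (I : IndexingSystem T) (b : (Fin d → ℕ) → ℝ) :
    jointKernel T a →L[ℂ] jointKernel T a :=
  ∑ F, ∑ u ∈ (finite_solutionSpaceIn_ne_bot a I F).toFinset,
    (b (depth T u) : ℂ) • (solutionSpaceIn T a u F).starProjection

variable {I : IndexingSystem T}

lemma depthDiag_apply (b : (Fin d → ℕ) → ℝ) (f : jointKernel T a) (w : ∀ i, V i) :
    (depthDiag a I b f).1 w = (b (depth T w) : ℂ) * f.1 w := by
  classical
  obtain ⟨⟨F, u⟩, hw, huniq⟩ := existsUnique_mem_sib I w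
  have hproj : ∀ p : Σ F, I.Ω F, evalVertex T a w ((solutionSpaceIn T a p.2 p.1).starProjection f) =
      if w ∈ sib T p.1 p.2 then f.1 w else 0 := fun p =>
    starProjection_apply T a p.2 p.1 (I.subset_Phi p.1 p.2.2) f w
  change evalVertex T a w _ = _
  simp only [depthDiag, sum_apply, FunLike.coe_smul, Pi.smul_apply, map_sum, map_smul, smul_eq_mul]
  rw [Finset.sum_sigma', Finset.sum_eq_single ⟨F, u⟩]
  · rw [hproj ⟨F, u⟩, if_pos hw, depth_eq_of_mem_sib hw]
  · intro p _ hp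
    rw [hproj p, if_neg fun h => hp (huniq p h), mul_zero]
  · intro h
    have hbot : solutionSpaceIn T a u F = ⊥ := by simpa using h
    simp [hbot]

lemma depthDiag_one : depthDiag a I 1 = 1 :=
  ContinuousLinearMap.ext fun f => jointKernel_ext fun w => by
    rw [depthDiag_apply, Pi.one_apply, Complex.ofReal_one, one_mul, one_apply_eq_self]

lemma depthDiag_mul (b c : (Fin d → ℕ) → ℝ) :
    depthDiag a I b * depthDiag a I c = depthDiag a I (b * c) :=
  ContinuousLinearMap.ext fun f => jointKernel_ext fun w => by
    rw [mul_apply_eq_comp, depthDiag_apply, depthDiag_apply, depthDiag_apply,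
      Pi.mul_apply, Complex.ofReal_mul, mul_assoc]

lemma depthDiag_nonneg {b : (Fin d → ℕ) → ℝ} (hb : 0 ≤ b) : 0 ≤ depthDiag a I b :=
  Finset.sum_nonneg fun _ _ => Finset.sum_nonneg fun _ _ =>
    (ContinuousLinearMap.nonneg_iff_isPositive _).2 <|
      (ContinuousLinearMap.IsPositive.of_isStarProjection
        isStarProjection_starProjection).smul_of_nonneg (Complex.zero_le_real.2 (hb _))

lemma isStrictlyPositive_depthDiag {b : (Fin d → ℕ) → ℝ} (hb : ∀ n, 0 < b n) :
    IsStrictlyPositive (depthDiag a I b) := by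
  have hmul : b * b⁻¹ = 1 := funext fun n => mul_inv_cancel₀ (hb n).ne'
  refine IsUnit.isStrictlyPositive ⟨⟨depthDiag a I b, depthDiag a I b⁻¹, ?_, ?_⟩, rfl⟩
    (depthDiag_nonneg fun n => (hb n).le)
  · rw [depthDiag_mul, hmul, depthDiag_one]
  · rw [depthDiag_mul, mul_comm, hmul, depthDiag_one]

lemma mem_depthSpace_iff_depthDiag (had : a * d ≠ 1) {n : Fin d → ℕ} {f : jointKernel T a} :
    f ∈ depthSpace T a n ↔
      ∀ α, depthDiag a I (depthCoeff a · α) f = (depthCoeff a n α : ℂ) • f := by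
  rw [mem_depthSpace]
  refine ⟨fun hf α => jointKernel_ext fun w => ?_, fun hf w hw => ?_⟩
  · rw [depthDiag_apply]
    change _ = (depthCoeff a n α : ℂ) * f.1 w
    obtain h | h := eq_or_ne (depth T w) n
    · rw [h]
    · rw [hf w h, mul_zero, mul_zero]
  · by_contra h
    refine hw (eq_of_depthCoeff_eq had fun α => ?_)
    have hα := congrArg (evalVertex T a w) (hf α)
    rw [map_smul] at hα
    exact Complex.ofReal_injective
      (mul_right_cancel₀ h ((depthDiag_apply _ f w).symm.trans hα))

lemma iSup_solutionSpaceIn (n : Fin d → ℕ) :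
    ⨆ u ∈ {u | u ∈ I.Ω ({i | n i ≠ 0} : Finset (Fin d)) ∧ depth T u = n},
      solutionSpaceIn T a u {i | n i ≠ 0} = depthSpace T a n := by
  classical
  refine le_antisymm (iSup₂_le fun u hu => hu.2 ▸ solutionSpaceIn_le_depthSpace u _) fun f hf => ?_
  have hsum : depthDiag a I 1 f = f := by rw [depthDiag_one, one_apply_eq_self]
  rw [← hsum]
  simp only [depthDiag, sum_apply, Pi.one_apply, Complex.ofReal_one, one_smul]
  refine Submodule.sum_mem _ fun F _ => Submodule.sum_mem _ fun ⟨u, hu⟩ _ => ?_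
  obtain rfl | hn := eq_or_ne (depth T u) n
  · obtain rfl := mem_Phi_iff.1 (I.subset_Phi F hu)
    exact Submodule.mem_iSup_of_mem u
      (Submodule.mem_iSup_of_mem ⟨hu, rfl⟩ (Submodule.starProjection_apply_mem _ f))
  · convert Submodule.zero_mem _
    refine jointKernel_ext fun w => ?_
    rw [starProjection_apply T a u F (I.subset_Phi F hu)]
    refine ite_eq_right_iff.2 fun hw => mem_depthSpace.1 hf w ?_
    rwa [depth_eq_of_mem_sib hw]

lemma levelSpace_support (n : Fin d → ℕ) :
    levelSpace a I n {i | n i ≠ 0} = (depthSpace T a n).map (constFn a I).toLinearMap := by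
  rw [← iSup_solutionSpaceIn (I := I)]
  simp only [levelSpace, Submodule.map_iSup]

lemma levelSpace_eq_bot {n : Fin d → ℕ} {F : Finset (Fin d)}
    (hF : F ≠ ({i | n i ≠ 0} : Finset (Fin d))) : levelSpace a I n F = ⊥ :=
  iSup₂_eq_bot.2 fun u hu => by
    obtain ⟨hu, rfl⟩ := hu
    exact absurd (mem_Phi_iff.1 (I.subset_Phi F hu)) hF

lemma hasPowerSeriesKernel :
    HasPowerSeriesKernel (DruryArveson a I) fun α => depthDiag a I (depthCoeff a · α) where
  isStrictlyPositive α := isStrictlyPositive_depthDiag fun n => depthCoeff_pos a n α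
  coeff_zero := by
    simp only [depthCoeff_zero]
    exact depthDiag_one
  hasSum_kernel z w g := by
    rw [RKHS.OfKernel.kernel_ofKernel, kernel_eq_sum]
    simp only [depthDiag, sum_apply, FunLike.coe_smul, Pi.smul_apply, Finset.smul_sum, smul_smul]
    refine hasSum_sum fun F _ => hasSum_sum fun u _ => HasSum.smul_const ?_ _
    exact ((summable_scalarKernel T a u.1 _ (kernelCoeff_nonneg T a u.1) (fun _ => le_rfl)
      z w).hasSum).congr_fun fun α => mul_comm _ _

end DepthDiag

section Isomorphism

variable {d a : ℕ} [NeZero a] {V₁ V₂ : Fin d → Type*}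
  {T₁ : ∀ i, RootedDirectedTree (V₁ i)} {T₂ : ∀ i, RootedDirectedTree (V₂ i)}
  [∀ i, (T₁ i).LocallyFinite] [∀ i, (T₁ i).FiniteBranchingIndex]
  [∀ i, (T₂ i).LocallyFinite] [∀ i, (T₂ i).FiniteBranchingIndex]
  {I₁ : IndexingSystem T₁} {I₂ : IndexingSystem T₂}
  {U : DruryArveson a I₁ ≃ₗᵢ[ℂ] DruryArveson a I₂}

lemma exists_linearIsometryEquiv_depthSpace (had : a * d ≠ 1) (hU : IsHilbertModuleIso U) :
    ∃ W : jointKernel T₁ a ≃ₗᵢ[ℂ] jointKernel T₂ a,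
      (∀ g, U (constFn a I₁ g) = constFn a I₂ (W g)) ∧
      ∀ n, (depthSpace T₁ a n).map W.toLinearEquiv.toLinearMap = depthSpace T₂ a n := by
  obtain ⟨W, hconst, hcoeff⟩ := hasPowerSeriesKernel.exists_linearIsometryEquiv_coeff
    hasPowerSeriesKernel (mulCoord_apply a I₁) (mulCoord_apply a I₂) hU
  refine ⟨W, hconst, fun n => Submodule.ext fun x => ?_⟩
  obtain ⟨g, rfl⟩ := W.surjective x
  refine (W.injective.mem_set_image (s := depthSpace T₁ a n)).trans ?_
  rw [SetLike.mem_coe, mem_depthSpace_iff_depthDiag (I := I₁) had,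
    mem_depthSpace_iff_depthDiag (I := I₂) had]
  simp only [← hcoeff, ← map_smul, W.injective.eq_iff]

lemma map_levelSpace {W : jointKernel T₁ a ≃ₗᵢ[ℂ] jointKernel T₂ a}
    (hconst : ∀ g, U (constFn a I₁ g) = constFn a I₂ (W g))
    (hW : ∀ n, (depthSpace T₁ a n).map W.toLinearEquiv.toLinearMap = depthSpace T₂ a n)
    (n : Fin d → ℕ) (F : Finset (Fin d)) :
    (levelSpace a I₁ n F).map U.toLinearEquiv.toLinearMap = levelSpace a I₂ n F := by
  obtain rfl | hF := eq_or_ne F ({i | n i ≠ 0} : Finset (Fin d))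
  · rw [levelSpace_support, levelSpace_support, ← hW, ← Submodule.map_comp, ← Submodule.map_comp]
    exact congrArg (Submodule.map · _) (LinearMap.ext hconst)
  · rw [levelSpace_eq_bot hF, levelSpace_eq_bot hF, Submodule.map_bot]

end Isomorphism

section Root

variable {d : ℕ} {V : Fin d → Type*} {T : ∀ i, RootedDirectedTree (V i)}
  [∀ i, (T i).LocallyFinite] {a : ℕ}

lemma eRoot_apply : (eRoot T a).1 (root T) = 1 := by
  classical exact lp.single_apply_self ..

lemma eRoot_apply_of_ne {v : ∀ i, V i} (hv : v ≠ root T) : (eRoot T a).1 v = 0 := by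
  classical exact lp.single_apply_ne _ _ _ hv

lemma norm_eRoot : ‖eRoot T a‖ = 1 := by
  classical exact (lp.norm_single (by norm_num) _ _).trans norm_one

lemma depthSpace_zero : depthSpace T a 0 = ℂ ∙ eRoot T a := by
  refine le_antisymm (fun f hf => Submodule.mem_span_singleton.2
    ⟨f.1 (root T), jointKernel_ext fun w => ?_⟩) ?_
  · change f.1 (root T) * (eRoot T a).1 w = f.1 w
    obtain rfl | hw := eq_or_ne w (root T)
    · rw [eRoot_apply, mul_one]
    · rw [eRoot_apply_of_ne hw, mul_zero, mem_depthSpace.1 hf w (depth_eq_zero_iff.not.2 hw)]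
  · rw [Submodule.span_singleton_le_iff_mem, mem_depthSpace]
    exact fun w hw => eRoot_apply_of_ne (mt depth_eq_zero_iff.2 hw)

end Root

end TreeProduct

end

theorem proposition3p2_general {d a : ℕ} [NeZero a] (had : a * d ≠ 1)
    {V₁ V₂ : Fin d → Type*}
    (T₁ : ∀ i, RootedDirectedTree (V₁ i)) (T₂ : ∀ i, RootedDirectedTree (V₂ i))
    [∀ i, (T₁ i).LocallyFinite] [∀ i, (T₁ i).FiniteBranchingIndex]
    [∀ i, (T₂ i).LocallyFinite] [∀ i, (T₂ i).FiniteBranchingIndex]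
    (I₁ : TreeProduct.IndexingSystem T₁) (I₂ : TreeProduct.IndexingSystem T₂)
    (U : TreeProduct.DruryArveson a I₁ ≃ₗᵢ[ℂ] TreeProduct.DruryArveson a I₂)
    (hU : TreeProduct.IsHilbertModuleIso U) :
    (∀ (α : Fin d → ℕ) (F : Finset (Fin d)),
      (TreeProduct.levelSpace a I₁ α F).map U.toLinearEquiv.toLinearMap =
        TreeProduct.levelSpace a I₂ α F) ∧
    ∃ c : ℂ, ‖c‖ = 1 ∧
      U (TreeProduct.constFn a I₁ (TreeProduct.eRoot T₁ a)) =
        c • TreeProduct.constFn a I₂ (TreeProduct.eRoot T₂ a) := by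
  obtain ⟨W, hconst, hW⟩ := TreeProduct.exists_linearIsometryEquiv_depthSpace had hU
  refine ⟨TreeProduct.map_levelSpace hconst hW, ?_⟩
  obtain ⟨c, hc⟩ : ∃ c : ℂ, c • TreeProduct.eRoot T₂ a = W (TreeProduct.eRoot T₁ a) := by
    rw [← Submodule.mem_span_singleton, ← TreeProduct.depthSpace_zero, ← hW,
      TreeProduct.depthSpace_zero]
    exact Submodule.mem_map_of_mem (Submodule.mem_span_singleton_self _)
  refine ⟨c, ?_, by rw [hconst, ← hc, map_smul]⟩
  simpa only [norm_smul, TreeProduct.norm_eRoot, mul_one, W.norm_map] using congrArg norm hc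

theorem proposition3p2 {d a : ℕ} [NeZero d] [NeZero a] (had : a * d ≠ 1)
    {V₁ V₂ : Fin d → Type*}
    (T₁ : ∀ i, RootedDirectedTree (V₁ i)) (T₂ : ∀ i, RootedDirectedTree (V₂ i))
    [∀ i, (T₁ i).LocallyFinite] [∀ i, (T₁ i).Leafless] [∀ i, (T₁ i).FiniteBranchingIndex]
    [∀ i, (T₂ i).LocallyFinite] [∀ i, (T₂ i).Leafless] [∀ i, (T₂ i).FiniteBranchingIndex]
    (I₁ : TreeProduct.IndexingSystem T₁) (I₂ : TreeProduct.IndexingSystem T₂)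
    (U : TreeProduct.DruryArveson a I₁ ≃ₗᵢ[ℂ] TreeProduct.DruryArveson a I₂)
    (hU : TreeProduct.IsHilbertModuleIso U) :
    (∀ (α : Fin d → ℕ) (F : Finset (Fin d)),
      (TreeProduct.levelSpace a I₁ α F).map U.toLinearEquiv.toLinearMap =
        TreeProduct.levelSpace a I₂ α F) ∧
    ∃ c : ℂ, ‖c‖ = 1 ∧
      U (TreeProduct.constFn a I₁ (TreeProduct.eRoot T₁ a)) =
        c • TreeProduct.constFn a I₂ (TreeProduct.eRoot T₂ a) :=
  proposition3p2_general had T₁ T₂ I₁ I₂ U hU
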